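/- Let $X$ be a connected Riemann surface (for instance a compact one of genus $g\ge 2$) with holomorphic tangent bundle $TX$ and holomorphic cotangent bundle $K=K_X$, and let $n,m\ge 2$ be integers. All subbundles below are holomorphic. Let $E$ be a holomorphic vector bundle of rank $2n$ on $X$ with $\bigwedge^{2n}E\cong\mathcal O_X$, let $B_0$ be a fibrewise nondegenerate holomorphic symmetric bilinear form on $E$, and let $$0=F_0\subset F_1\subset\cdots\subset F_{2m}\subset F_{2m+1}=E$$ be a filtration by subbundles such that $\operatorname{rank}(F_{m+1}/F_m)=2\operatorname{rank}F_1$, $\operatorname{rank}(F_i/F_{i-1})=\operatorname{rank}F_1$ for all $i\in\{1,\dots,2m+1\}\setminus\{m+1\}$, and $F_i^{\perp}=F_{2m+1-i}$ for $0\le i\le m$, where $\perp$ is taken with respect to $B_0$. Let $D:E\to E\otimes K$ be a holomorphic connection with $dB_0(s,t)=B_0(Ds,t)+B_0(s,Dt)$ such that 1. $D(F_i)\subset F_{i+1}\otimes K$ for $1\le i\le 2m$; 2. the second fundamental form $S(D,i):F_i/F_{i-1}\to (F_{i+1}/F_i)\otimes K$, $[s]\mapsto [Ds]$, is an isomorphism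 for all $i\in\{1,\dots,2m\}\setminus\{m,m+1\}$; 3. the composition $(S(D,m+1)\otimes \mathrm{Id}_K)\circ S(D,m):F_m/F_{m-1}\to (F_{m+2}/F_{m+1})\otimes K^{\otimes 2}$ is an isomorphism. (That is, $(E,B_0,F_\bullet,D)$ is a generalized $\mathrm{SO}(2n,\mathbb C)$-quasioper.) For a holomorphic vector bundle $W$ with a holomorphic connection $D_W$ and a subbundle $V\subset W$, let $\widehat D_W(V)$ be the smallest subbundle $U\subset W$ containing $V$ with $D_W(V)\subset U\otimes K$, and let $\widehat D_W^{\,k}$ denote the $k$-fold iterate of $\widehat D_W$. Put $$\mathbb F=\widehat D_E^{\,2m}(F_1)\subset E .$$ Let $D^*$ be the dual connection on $E^*$, let $G_1=\ker\big(E^*\to (F_{2m})^*\big)$ and $\mathbb G=\widehat{D^*}_{E^*}^{\,2m}(G_1)\subset E^*$, and let $$\mathcal S=(E^*/\mathbb G)^*\subset E^{**}=E,$$ i.e. $\mathcal S_x$ is the common zero space in $E_x$ of the functionals in $\mathbb G_x$. Let $Q=E/F_{2m}$ with quotient map $q:E\to Q$, and let $J^{2m}(Q)$ be its jet bundle of order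 $2m$. Then $D$ induces a homomorphism of holomorphic vector bundles $$f_{2m}:E\to J^{2m}(Q),$$ which sends $v\in E_x$ to the $2m$-jet at $x$ of $q(\widetilde v)$, where $\widetilde v$ is the flat section of $(E,D)$ near $x$ with $\widetilde v(x)=v$. Moreover $\mathbb F$ and $\mathcal S$ are holomorphic subbundles of $E$, the composition $$\mathbb F\hookrightarrow E\xrightarrow{\ f_{2m}\ }J^{2m}(Q)$$ is an isomorphism of holomorphic vector bundles, and $\ker(f_{2m})=\mathcal S$. -/

import Mathlib

open Bundle Filter
open scoped Manifold ContDiff Topology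

noncomputable section

namespace Quasioper

/-! ## Families of vector spaces and their germs of holomorphic sections -/

section Families

variable {X : Type*} [TopologicalSpace X] [ChartedSpace ℂ X]

/-- `g` is holomorphic (complex analytic) in a neighbourhood of `x`. -/
abbrev HolAt (g : X → ℂ) (x : X) : Prop :=
  ContMDiffAt 𝓘(ℂ, ℂ) 𝓘(ℂ, ℂ) ω g x

/-- A holomorphic structure on a family of vector spaces `V x`, `x ∈ X`, given by its germs of
holomorphic sections: for every `x` the space of those sections which are holomorphic near `x`.
A local section is represented by an arbitrary extension to all of `X`. -/
abbrev HolGerms (V : X → Type*) [∀ x, AddCommGroup (V x)] [∀ x, Module ℂ (V x)] :=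
  ∀ _ : X, Submodule ℂ (Π y, V y)

variable {V W : X → Type*} [∀ x, AddCommGroup (V x)] [∀ x, Module ℂ (V x)]
  [∀ x, AddCommGroup (W x)] [∀ x, Module ℂ (W x)]

/-- A fibrewise linear map is a homomorphism of holomorphic bundles if it takes
holomorphic sections to holomorphic sections. -/
def IsHolHom (Γ : HolGerms V) (Γ' : HolGerms W) (f : ∀ x, V x →ₗ[ℂ] W x) : Prop :=
  ∀ x, ∀ σ ∈ Γ x, (fun y => f y (σ y)) ∈ Γ' x

/-- An isomorphism of holomorphic bundles: fibrewise bijective, and holomorphic sections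
correspond to holomorphic sections in both directions. -/
def IsHolIso (Γ : HolGerms V) (Γ' : HolGerms W) (f : ∀ x, V x →ₗ[ℂ] W x) : Prop :=
  (∀ x, Function.Bijective (f x)) ∧ ∀ x, ∀ σ : Π y, V y, σ ∈ Γ x ↔ (fun y => f y (σ y)) ∈ Γ' x

/-! ### Jets -/

/-- The subspace `𝔪_x ^ (k + 1) · Γ_x` of `Γ_x`: the sections vanishing at `x` to order at least
`k + 1`. -/
def vanishing (Γ : HolGerms V) (k : ℕ) (x : X) : Submodule ℂ (Γ x) :=
  Submodule.span ℂ {σ | ∃ (h : Fin (k + 1) → X → ℂ) (τ : Γ x),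
    (∀ i, HolAt (h i) x ∧ h i x = 0) ∧ (σ : Π y, V y) = fun y => (∏ i, h i y) • τ.1 y}

/-- The fibre at `x` of the jet bundle of order `k`: `Γ_x / 𝔪_x ^ (k + 1) · Γ_x`, the restrictions
of holomorphic sections to the infinitesimal neighbourhood of order `k` of `x`. -/
abbrev JetFiber (Γ : HolGerms V) (k : ℕ) (x : X) : Type _ :=
  Γ x ⧸ vanishing Γ k x

open Classical in
/-- The `k`-jet at `x` of a section which is holomorphic near `x` (and `0` for other sections). -/
def jetAt (Γ : HolGerms V) (k : ℕ) (x : X) (σ : Π y, V y) : JetFiber Γ k x :=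
  if h : σ ∈ Γ x then (vanishing Γ k x).mkQ ⟨σ, h⟩ else 0

/-- The holomorphic structure of the jet bundle: its sheaf of holomorphic sections is generated,
over the holomorphic functions, by the prolongations `y ↦ jetAt Γ k y τ` of holomorphic sections. -/
def jetGerms (Γ : HolGerms V) (k : ℕ) : HolGerms (JetFiber Γ k) := fun x =>
  Submodule.span ℂ {σ | ∃ (g : X → ℂ) (τ : Π y, V y), HolAt g x ∧ τ ∈ Γ x ∧
    ∀ᶠ y in 𝓝 x, σ y = g y • jetAt Γ k y τ}

end Families

/-! ## Holomorphic vector bundles, subbundles, quotients -/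

section Bundles

variable {X : Type*} [TopologicalSpace X] [ChartedSpace ℂ X]
  (F : Type*) [NormedAddCommGroup F] [NormedSpace ℂ F]
  {E : X → Type*} [TopologicalSpace (TotalSpace F E)]
  [∀ x, AddCommGroup (E x)] [∀ x, Module ℂ (E x)] [∀ x, TopologicalSpace (E x)]
  [FiberBundle F E] [VectorBundle ℂ F E]

/-- The sections of a holomorphic vector bundle which are holomorphic near `x`. -/
def holGerms : HolGerms E := fun x =>
  { carrier := {s | ContMDiffAt 𝓘(ℂ, ℂ) (𝓘(ℂ, ℂ).prod 𝓘(ℂ, F)) ω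
      (fun y => TotalSpace.mk' F y (s y)) x}
    add_mem' := fun hs ht => hs.add_section ht
    zero_mem' := contMDiff_zeroSection ℂ E x
    smul_mem' := fun _ _ hs => hs.const_smul_section }

/-- `V` is a holomorphic subbundle: near every point it has a frame consisting of holomorphic
sections of the ambient bundle. -/
def IsHolSubbundle (V : ∀ x, Submodule ℂ (E x)) : Prop :=
  ∀ x, ∃ (k : ℕ) (s : Fin k → Π y, E y), (∀ i, s i ∈ holGerms F x) ∧
    ∀ᶠ y in 𝓝 x, LinearIndependent ℂ (fun i => s i y) ∧
      Submodule.span ℂ (Set.range fun i => s i y) = V y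

/-- The holomorphic structure of a subbundle. -/
def subGerms (V : ∀ x, Submodule ℂ (E x)) : HolGerms (fun x => V x) := fun x =>
  { carrier := {σ | (fun y => (σ y : E y)) ∈ holGerms F x}
    add_mem' := fun hs ht => (holGerms F x).add_mem hs ht
    zero_mem' := (holGerms F x).zero_mem
    smul_mem' := fun c _ hs => (holGerms F x).smul_mem c hs }

/-- The holomorphic structure of the quotient by a subbundle: a section is holomorphic if it
locally lifts to a holomorphic section. -/
def quotGerms (V : ∀ x, Submodule ℂ (E x)) : HolGerms (fun x => E x ⧸ V x) := fun x =>
  { carrier := {σ | ∃ s ∈ holGerms F x, ∀ᶠ y in 𝓝 x, σ y = (V y).mkQ (s y)}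
    add_mem' := by
      rintro σ τ ⟨s, hs, hs'⟩ ⟨t, ht, ht'⟩
      refine ⟨s + t, (holGerms F x).add_mem hs ht, ?_⟩
      filter_upwards [hs', ht'] with y h h'
      simp only [Pi.add_apply, h, h', map_add]
    zero_mem' := ⟨0, (holGerms F x).zero_mem, .of_forall fun y => by simp⟩
    smul_mem' := by
      rintro c σ ⟨s, hs, hs'⟩
      refine ⟨c • s, (holGerms F x).smul_mem c hs, ?_⟩
      filter_upwards [hs'] with y h
      simp only [Pi.smul_apply, h, map_smul] }

/-- The fibre at `x` of the quotient `V₂ / V₁` for subbundles `V₁ ⊆ V₂`. -/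
abbrev Gr (V₁ V₂ : ∀ x, Submodule ℂ (E x)) (x : X) : Type _ :=
  V₂ x ⧸ (V₁ x).submoduleOf (V₂ x)

variable {F}

variable (E) in
/-- The fibres of the dual bundle `E^*`. -/
abbrev Dual (x : X) : Type _ := E x →L[ℂ] Trivial X ℂ x

theorem mdifferentiableAt_pairing {φ : Π y, Dual E y} {s : Π y, E y} {x : X}
    (hφ : MDifferentiableAt 𝓘(ℂ, ℂ) (𝓘(ℂ, ℂ).prod 𝓘(ℂ, F →L[ℂ] ℂ))
      (fun y => TotalSpace.mk' (F →L[ℂ] ℂ) y (φ y)) x)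
    (hs : MDifferentiableAt 𝓘(ℂ, ℂ) (𝓘(ℂ, ℂ).prod 𝓘(ℂ, F))
      (fun y => TotalSpace.mk' F y (s y)) x) :
    MDifferentiableAt 𝓘(ℂ, ℂ) 𝓘(ℂ, ℂ) (fun y => (φ y (s y) : ℂ)) x := by
  have := MDifferentiableAt.clm_bundle_apply (F₁ := F) (F₂ := ℂ) (E₂ := Trivial X ℂ) hφ hs
  exact ((mdifferentiableAt_totalSpace 𝓘(ℂ, ℂ) _).1 this).2

end Bundles

/-! ## Holomorphic connections

A holomorphic connection is given by a covariant derivative `D` in the sense of Mathlib over the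
field `ℂ`, where `D s x v` is the derivative at `x` of the section `s` in the direction `v`, so that
`E ⊗ K` is the bundle with fibres `Hom (T_x X, E_x)`. -/

section Connections

variable {X : Type*} [TopologicalSpace X] [ChartedSpace ℂ X] [IsManifold 𝓘(ℂ, ℂ) ω X]
  {F : Type*} [NormedAddCommGroup F] [NormedSpace ℂ F]
  {E : X → Type*} [TopologicalSpace (TotalSpace F E)]
  [∀ x, AddCommGroup (E x)] [∀ x, Module ℂ (E x)] [∀ x, TopologicalSpace (E x)]
  [∀ x, IsTopologicalAddGroup (E x)] [∀ x, ContinuousSMul ℂ (E x)]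
  [FiberBundle F E] [VectorBundle ℂ F E]

/-- `D` takes holomorphic local sections of `E` to holomorphic local sections of `E ⊗ K`. -/
def IsHolConnection (D : CovariantDerivative 𝓘(ℂ, ℂ) F E) : Prop :=
  ∀ x, ∀ s ∈ holGerms F x,
    D s ∈ holGerms (ℂ →L[ℂ] F) (E := fun y => TangentSpace 𝓘(ℂ, ℂ) y →L[ℂ] E y) x

/-- `D(V) ⊆ U ⊗ K`. -/
def MapsInto (D : CovariantDerivative 𝓘(ℂ, ℂ) F E) (V U : ∀ x, Submodule ℂ (E x)) : Prop :=
  ∀ x, ∀ s ∈ holGerms F x, (∀ᶠ y in 𝓝 x, s y ∈ V y) →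
    ∀ v : TangentSpace 𝓘(ℂ, ℂ) x, D s x v ∈ U x

/-- `S : V₂/V₁ → (V₄/V₃) ⊗ K` is the second fundamental form of `(V₁, V₂, V₃, V₄)`: the value at
`x` on the class of a local holomorphic section `s` of `V₂` is the class of `D s` at `x`. -/
def IsSecondFundamentalForm (D : CovariantDerivative 𝓘(ℂ, ℂ) F E)
    (V₁ V₂ V₃ V₄ : ∀ x, Submodule ℂ (E x))
    (S : ∀ x, Gr V₁ V₂ x →ₗ[ℂ] TangentSpace 𝓘(ℂ, ℂ) x →ₗ[ℂ] Gr V₃ V₄ x) : Prop :=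
  ∀ x, ∀ s ∈ holGerms F x, ∀ hs : (∀ᶠ y in 𝓝 x, s y ∈ V₂ y), ∀ v : TangentSpace 𝓘(ℂ, ℂ) x,
    ∃ h : D s x v ∈ V₄ x,
      S x (Submodule.Quotient.mk ⟨s x, hs.self_of_nhds⟩) v = Submodule.Quotient.mk ⟨D s x v, h⟩

/-- The minimal holomorphic subbundle `U` containing `V` such that `D(V) ⊆ U ⊗ K`. It is defined
for all families `V`, as the fibrewise intersection of all such `U`; this is the least such `U`
as soon as there is a least one. -/
def Dhat (D : CovariantDerivative 𝓘(ℂ, ℂ) F E) (V : ∀ x, Submodule ℂ (E x)) :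
    ∀ x, Submodule ℂ (E x) :=
  sInf {U | IsHolSubbundle F U ∧ V ≤ U ∧ MapsInto D V U}

/-- `s` is holomorphic and flat near `x`, with `s x = v`. -/
def IsFlatThrough (D : CovariantDerivative 𝓘(ℂ, ℂ) F E) (x : X) (v : E x) (s : Π y, E y) : Prop :=
  s ∈ holGerms F x ∧ (∀ᶠ y in 𝓝 x, D s y = 0) ∧ s x = v

/-- `f : E → J^k(E/V)` is the homomorphism produced by `D`: through every `v ∈ E_x` there is a flat
section near `x`, and `f` sends `v` to the `k`-jet at `x` of the image in `E/V` of that section. -/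
def IsFlatJetMap (D : CovariantDerivative 𝓘(ℂ, ℂ) F E) (V : ∀ x, Submodule ℂ (E x)) (k : ℕ)
    (f : ∀ x, E x →ₗ[ℂ] JetFiber (quotGerms F V) k x) : Prop :=
  ∀ x v, (∃ s, IsFlatThrough D x v s) ∧
    ∀ s, IsFlatThrough D x v s → f x v = jetAt (quotGerms F V) k x (fun y => (V y).mkQ (s y))

/-! ### The dual connection -/

/-- The value `d(φ(s)) - φ(D s)` of the dual derivative of `φ` on a section `s`. -/
def dualPairing (D : CovariantDerivative 𝓘(ℂ, ℂ) F E) (φ : Π y, Dual E y) (x : X)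
    (v : TangentSpace 𝓘(ℂ, ℂ) x) (s : Π y, E y) : ℂ :=
  mvfderiv 𝓘(ℂ, ℂ) (fun y => (φ y (s y) : ℂ)) x v - φ x (D s x v)

theorem dualPairing_tensorial (D : CovariantDerivative 𝓘(ℂ, ℂ) F E) {φ : Π y, Dual E y} {x : X}
    (hφ : MDifferentiableAt 𝓘(ℂ, ℂ) (𝓘(ℂ, ℂ).prod 𝓘(ℂ, F →L[ℂ] ℂ))
      (fun y => TotalSpace.mk' (F →L[ℂ] ℂ) y (φ y)) x) (v : TangentSpace 𝓘(ℂ, ℂ) x) :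
    TensorialAt 𝓘(ℂ, ℂ) F (dualPairing D φ x v) x where
  smul := by
    intro f s hf hs
    have h := mdifferentiableAt_pairing hφ hs
    have e : (fun y => (φ y ((f • s) y) : ℂ)) = fun y => f y • (φ y (s y) : ℂ) := by
      ext y; exact map_smul (φ y) (f y) (s y)
    have e2 := D.isCovariantDerivativeOnUniv.leibniz hs hf
    have e3 := mvfderiv_smul hf h
    have e4 : (φ x ((f x • D s x + (mvfderiv 𝓘(ℂ, ℂ) f x).smulRight (s x)) v) : ℂ)
        = f x * (φ x (D s x v) : ℂ) + mvfderiv 𝓘(ℂ, ℂ) f x v * (φ x (s x) : ℂ) := by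
      have : ((f x • D s x + (mvfderiv 𝓘(ℂ, ℂ) f x).smulRight (s x)) v : E x)
        = f x • D s x v + mvfderiv 𝓘(ℂ, ℂ) f x v • s x := rfl
      rw [this]
      refine (map_add (φ x) _ _).trans ?_
      congr 1
      · exact map_smul (φ x) _ _
      · exact map_smul (φ x) _ _
    unfold dualPairing
    rw [e, e2]
    erw [e3, e4]
    simp
    ring
  add := by
    intro s t hs ht
    have h := mdifferentiableAt_pairing hφ hs
    have h' := mdifferentiableAt_pairing hφ ht
    have e : (fun y => (φ y ((s + t) y) : ℂ)) =
        (fun y => (φ y (s y) : ℂ)) + fun y => (φ y (t y) : ℂ) := by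
      ext y; exact map_add (φ y) (s y) (t y)
    have e2 := D.isCovariantDerivativeOnUniv.add hs ht
    have e3 := mvfderiv_add h h'
    have e4 : (φ x ((D s x + D t x) v) : ℂ) = (φ x (D s x v) : ℂ) + (φ x (D t x v) : ℂ) :=
      map_add (φ x) _ _
    unfold dualPairing
    rw [e, e2]
    erw [e3, e4]
    simp
    ring

variable [FiniteDimensional ℂ F] [ContMDiffVectorBundle ω F E 𝓘(ℂ, ℂ)]

open Classical in
/-- The dual derivative of `φ` (and `0` at points where `φ` is not differentiable). -/
def dualDerivative (D : CovariantDerivative 𝓘(ℂ, ℂ) F E) (φ : Π y, Dual E y) (x : X) :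
    TangentSpace 𝓘(ℂ, ℂ) x →L[ℂ] Dual E x :=
  if hφ : MDifferentiableAt 𝓘(ℂ, ℂ) (𝓘(ℂ, ℂ).prod 𝓘(ℂ, F →L[ℂ] ℂ))
      (fun y => TotalSpace.mk' (F →L[ℂ] ℂ) y (φ y)) x then
    have : FiniteDimensional ℂ (TangentSpace 𝓘(ℂ, ℂ) x) :=
      inferInstanceAs (FiniteDimensional ℂ ℂ)
    have : T2Space (TangentSpace 𝓘(ℂ, ℂ) x) := inferInstanceAs (T2Space ℂ)
    LinearMap.toContinuousLinearMap
      { toFun := fun v => TensorialAt.mkHom _ x (dualPairing_tensorial D hφ v)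
        map_add' := by
          intro v w
          ext u
          change dualPairing D φ x (v + w) (FiberBundle.extend F u) =
            dualPairing D φ x v (FiberBundle.extend F u) +
              dualPairing D φ x w (FiberBundle.extend F u)
          unfold dualPairing
          rw [map_add, map_add]
          erw [map_add (φ x)]
          exact add_sub_add_comm _ _ _ _
        map_smul' := by
          intro c v
          ext u
          change dualPairing D φ x (c • v) (FiberBundle.extend F u) =
            c • dualPairing D φ x v (FiberBundle.extend F u)
          unfold dualPairing
          rw [map_smul, map_smul]
          erw [map_smul (φ x)]
          exact (smul_sub _ _ _).symm }
  else 0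

theorem dualDerivative_apply (D : CovariantDerivative 𝓘(ℂ, ℂ) F E) {φ : Π y, Dual E y} {x : X}
    (hφ : MDifferentiableAt 𝓘(ℂ, ℂ) (𝓘(ℂ, ℂ).prod 𝓘(ℂ, F →L[ℂ] ℂ))
      (fun y => TotalSpace.mk' (F →L[ℂ] ℂ) y (φ y)) x) {s : Π y, E y}
    (hs : MDifferentiableAt 𝓘(ℂ, ℂ) (𝓘(ℂ, ℂ).prod 𝓘(ℂ, F))
      (fun y => TotalSpace.mk' F y (s y)) x) (v : TangentSpace 𝓘(ℂ, ℂ) x) :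
    (dualDerivative D φ x v (s x) : ℂ) =
      mvfderiv 𝓘(ℂ, ℂ) (fun y => (φ y (s y) : ℂ)) x v - φ x (D s x v) := by
  rw [dualDerivative, dif_pos hφ]
  exact TensorialAt.mkHom_apply (dualPairing_tensorial D hφ v) hs

/-- The dual connection. -/
def dualConnection (D : CovariantDerivative 𝓘(ℂ, ℂ) F E) :
    CovariantDerivative 𝓘(ℂ, ℂ) (F →L[ℂ] ℂ) (Dual E) where
  toFun := dualDerivative D
  isCovariantDerivativeOnUniv :=
    { add := by
        intro φ ψ x hφ hψ _
        refine ContinuousLinearMap.ext fun v => ContinuousLinearMap.ext fun u => ?_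
        obtain ⟨s, hs, rfl⟩ : ∃ s : Π y, E y, MDifferentiableAt 𝓘(ℂ, ℂ) (𝓘(ℂ, ℂ).prod 𝓘(ℂ, F))
            (fun y => TotalSpace.mk' F y (s y)) x ∧ s x = u :=
          ⟨FiberBundle.extend F u, FiberBundle.mdifferentiableAt_extend .., by simp⟩
        have h := mvfderiv_add (mdifferentiableAt_pairing hφ hs) (mdifferentiableAt_pairing hψ hs)
        have h' := congrArg (fun L => L v) h
        change (dualDerivative D (φ + ψ) x v (s x) : ℂ) =
          (dualDerivative D φ x v (s x) : ℂ) + (dualDerivative D ψ x v (s x) : ℂ)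
        rw [dualDerivative_apply D hφ hs, dualDerivative_apply D hψ hs,
          dualDerivative_apply D (mdifferentiableAt_add_section hφ hψ) hs]
        refine (congrArg (fun z : ℂ => z - ((φ + ψ) x (D s x v) : ℂ)) h').trans ?_
        exact add_sub_add_comm _ _ _ _
      leibniz := by
        intro φ g x hφ hg _
        refine ContinuousLinearMap.ext fun v => ContinuousLinearMap.ext fun u => ?_
        obtain ⟨s, hs, rfl⟩ : ∃ s : Π y, E y, MDifferentiableAt 𝓘(ℂ, ℂ) (𝓘(ℂ, ℂ).prod 𝓘(ℂ, F))
            (fun y => TotalSpace.mk' F y (s y)) x ∧ s x = u :=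
          ⟨FiberBundle.extend F u, FiberBundle.mdifferentiableAt_extend .., by simp⟩
        have h := mvfderiv_smul hg (mdifferentiableAt_pairing hφ hs)
        have h' := congrArg (fun L => L v) h
        change (dualDerivative D (g • φ) x v (s x) : ℂ) =
          g x * (dualDerivative D φ x v (s x) : ℂ) + mvfderiv 𝓘(ℂ, ℂ) g x v * (φ x (s x) : ℂ)
        rw [dualDerivative_apply D hφ hs, dualDerivative_apply D (hg.smul_section hφ) hs]
        refine (congrArg (fun z : ℂ => z - ((g • φ) x (D s x v) : ℂ)) h').trans ?_
        change g x * mvfderiv 𝓘(ℂ, ℂ) (fun y => (φ y (s y) : ℂ)) x v +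
          mvfderiv 𝓘(ℂ, ℂ) g x v * (φ x (s x) : ℂ) - g x * (φ x (D s x v) : ℂ) = _
        ring }

/-! ### Quasiopers -/

/-- `(E, B)` is an `SO(2n, ℂ)`-bundle: `E` has rank `2n` and trivial determinant (witnessed by a
nowhere vanishing holomorphic section `ω'` of the dual of `⋀^{2n} E`), and `B` is a fibrewise
nondegenerate holomorphic symmetric bilinear form on `E`. -/
structure IsSOBundle (n : ℕ) (B : ∀ x, LinearMap.BilinForm ℂ (E x)) : Prop where
  rank : ∀ x, Module.finrank ℂ (E x) = 2 * n
  det_trivial : ∃ ω' : ∀ x, E x [⋀^Fin (2 * n)]→ₗ[ℂ] ℂ, (∀ x, ω' x ≠ 0) ∧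
    ∀ x, ∀ s : Fin (2 * n) → Π y, E y, (∀ i, s i ∈ holGerms F x) →
      HolAt (fun y => ω' y fun i => s i y) x
  symm : ∀ x, (B x).IsSymm
  nondegenerate : ∀ x, (B x).Nondegenerate
  holomorphic : ∀ x, ∀ s ∈ holGerms F x, ∀ t ∈ holGerms F x, HolAt (fun y => B y (s y) (t y)) x

/-- `0 = Fil 0 ⊆ Fil 1 ⊆ ⋯ ⊆ Fil (2m+1) = E` is a filtration of length `2m+1` of the
`SO(2n, ℂ)`-bundle `(E, B)`. The values `Fil i` for `i > 2m+1` play no role. -/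
structure IsSOFiltration (m : ℕ) (B : ∀ x, LinearMap.BilinForm ℂ (E x))
    (Fil : ℕ → ∀ x, Submodule ℂ (E x)) : Prop where
  zero : Fil 0 = ⊥
  top : Fil (2 * m + 1) = ⊤
  subbundle : ∀ i ≤ 2 * m + 1, IsHolSubbundle F (Fil i)
  mono : ∀ i ≤ 2 * m, Fil i ≤ Fil (i + 1)
  rank_middle : ∀ x, Module.finrank ℂ (Gr (Fil m) (Fil (m + 1)) x) =
    2 * Module.finrank ℂ (Fil 1 x)
  rank_gr : ∀ i ∈ Finset.Icc 1 (2 * m + 1), i ≠ m + 1 →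
    ∀ x, Module.finrank ℂ (Gr (Fil (i - 1)) (Fil i) x) = Module.finrank ℂ (Fil 1 x)
  perp : ∀ i ≤ m, ∀ x, (B x).orthogonal (Fil i x) = Fil (2 * m + 1 - i) x

/-- `D` is a holomorphic connection on the filtered `SO(2n, ℂ)`-bundle `(E, B, Fil)`. -/
structure IsFilteredConnection (m : ℕ) (B : ∀ x, LinearMap.BilinForm ℂ (E x))
    (Fil : ℕ → ∀ x, Submodule ℂ (E x)) (D : CovariantDerivative 𝓘(ℂ, ℂ) F E) : Prop where
  holomorphic : IsHolConnection D
  compatible : ∀ x, ∀ s ∈ holGerms F x, ∀ t ∈ holGerms F x, ∀ v : TangentSpace 𝓘(ℂ, ℂ) x,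
    mvfderiv 𝓘(ℂ, ℂ) (fun y => B y (s y) (t y)) x v = B x (D s x v) (t x) + B x (s x) (D t x v)
  transversal : ∀ i ∈ Finset.Icc 1 (2 * m), MapsInto D (Fil i) (Fil (i + 1))
  iso : ∀ i ∈ Finset.Icc 1 (2 * m), i ≠ m → i ≠ m + 1 →
    ∃ S, IsSecondFundamentalForm D (Fil (i - 1)) (Fil i) (Fil i) (Fil (i + 1)) S ∧
      ∀ x, Function.Bijective (S x)
  /-- The fibre of `(Fil (m+2) / Fil (m+1)) ⊗ K ⊗ K` at `x` is the space of bilinear maps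
  `T_x X × T_x X → Fil (m+2) x / Fil (m+1) x`. -/
  iso_middle :
    ∃ S S', IsSecondFundamentalForm D (Fil (m - 1)) (Fil m) (Fil m) (Fil (m + 1)) S ∧
      IsSecondFundamentalForm D (Fil m) (Fil (m + 1)) (Fil (m + 1)) (Fil (m + 2)) S' ∧
      ∀ x, Function.Bijective fun u => S' x ∘ₗ S x u

/-- `(E, B, Fil, D)` is a generalized `SO(2n, ℂ)`-quasioper with filtration length `2m+1`. -/
structure IsQuasioper (n m : ℕ) (B : ∀ x, LinearMap.BilinForm ℂ (E x))
    (Fil : ℕ → ∀ x, Submodule ℂ (E x)) (D : CovariantDerivative 𝓘(ℂ, ℂ) F E) : Prop where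
  bundle : IsSOBundle (F := F) n B
  filtration : IsSOFiltration (F := F) m B Fil
  connection : IsFilteredConnection m B Fil D

/-- The subbundle `𝔽 = D̂^{2m}(F₁)` of `E`. -/
def subF (m : ℕ) (Fil : ℕ → ∀ x, Submodule ℂ (E x)) (D : CovariantDerivative 𝓘(ℂ, ℂ) F E) :
    ∀ x, Submodule ℂ (E x) :=
  (Dhat D)^[2 * m] (Fil 1)

/-- The kernel of the restriction map `E^* → V^*`. -/
def dualAnnihilator (V : ∀ x, Submodule ℂ (E x)) (x : X) : Submodule ℂ (Dual E x) where
  carrier := {φ | ∀ v ∈ V x, (φ v : ℂ) = 0}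
  add_mem' := fun {φ ψ} hφ hψ v hv => by
    have : ((φ + ψ) v : ℂ) = (φ v : ℂ) + (ψ v : ℂ) := rfl
    rw [this, hφ v hv, hψ v hv, add_zero]
  zero_mem' := fun _ _ => rfl
  smul_mem' := fun c φ hφ v hv => by
    have : ((c • φ) v : ℂ) = c * (φ v : ℂ) := rfl
    rw [this, hφ v hv, mul_zero]

/-- The subbundle `𝔾 = (D̂^*)^{2m}(G₁)` of `E^*`, where `G₁` is the kernel of
`E^* → (F_{2m})^*`. -/
def subG (m : ℕ) (Fil : ℕ → ∀ x, Submodule ℂ (E x)) (D : CovariantDerivative 𝓘(ℂ, ℂ) F E) :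
    ∀ x, Submodule ℂ (Dual E x) :=
  (Dhat (dualConnection D))^[2 * m] (dualAnnihilator (Fil (2 * m)))

/-- The subbundle `𝒮 = (E^*/𝔾)^*` of `E^{**} = E`: the vectors on which all elements of `𝔾`
vanish. -/
def subS (m : ℕ) (Fil : ℕ → ∀ x, Submodule ℂ (E x)) (D : CovariantDerivative 𝓘(ℂ, ℂ) F E)
    (x : X) : Submodule ℂ (E x) where
  carrier := {v | ∀ φ ∈ subG m Fil D x, (φ v : ℂ) = 0}
  add_mem' := fun {v w} hv hw φ hφ => by
    have : (φ (v + w) : ℂ) = (φ v : ℂ) + (φ w : ℂ) := map_add φ v w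
    rw [this, hv φ hφ, hw φ hφ, add_zero]
  zero_mem' := fun φ _ => map_zero φ
  smul_mem' := fun c v hv φ hφ => by
    have : (φ (c • v) : ℂ) = c * (φ v : ℂ) := map_smul φ c v
    rw [this, hv φ hφ, mul_zero]

end Connections

end Quasioper

end

/-!
Work near a point, with `∇` the derivative along `d/dz` for a chart `z`. Transversality and the
isomorphisms between the graded pieces of the filtration say that `∇ʲ` maps `F₁` into `F_{2m}` for
`j < N = 2m`, and that `∇ᴺ` induces an isomorphism `F₁ ≃ E / F_{2m}`. So a frame `s` of `F₁` has a
companion frame `φ` of the annihilator of `F_{2m}` with `φᵢ(∇ᴺ sₗ) = δᵢₗ`. Moving derivatives across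
the pairing gives `(∇*ᵏ φᵢ)(∇ʲ sₗ) = 0` for `k + j < N` and `(-1)ᵏ δᵢₗ` for `k + j = N`: the matrix
of these pairings is block antitriangular, hence invertible. Consequently the `∇ʲ sₗ` are a frame of
`𝔽` and the `∇*ᵏ φᵢ` a frame of `𝔾`. The `k`-th derivative of `φᵢ` along a flat section `w` is
`(∇*ᵏ φᵢ)(w)`, so in the Taylor coordinates on the jet bundle the map `f` is
`v ↦ ((∇*ᵏ φᵢ)(v))`. Its kernel is therefore the common zero space of `𝔾`, and its matrix on `𝔽` is
the invertible matrix above.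
-/

noncomputable section

namespace Quasioper

section ODE

/-- The Taylor coefficients of the solution of `Y' = A * Y`, `Y 0 = 1`, where `A` has the Taylor
coefficients `a`. -/
def odeCoeff {𝔸 : Type*} [Ring 𝔸] [Algebra ℂ 𝔸] (a : ℕ → 𝔸) : ℕ → 𝔸
  | 0 => 1
  | k + 1 => ((k + 1 : ℕ) : ℂ)⁻¹ • ∑ j : Fin (k + 1), a (k - j) * odeCoeff a j
decreasing_by exact j.2

theorem succ_smul_odeCoeff {𝔸 : Type*} [Ring 𝔸] [Algebra ℂ 𝔸] (a : ℕ → 𝔸) (k : ℕ) :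
    (k + 1) • odeCoeff a (k + 1) =
      ∑ p ∈ Finset.HasAntidiagonal.antidiagonal k, a p.1 * odeCoeff a p.2 := by
  rw [← Nat.cast_smul_eq_nsmul ℂ, odeCoeff, smul_inv_smul₀ (by exact_mod_cast k.succ_ne_zero),
    ← Finset.Nat.sum_antidiagonal_swap, Finset.Nat.sum_antidiagonal_eq_sum_range_succ_mk,
    Finset.sum_range]
  rfl

theorem norm_odeCoeff_le {𝔸 : Type*} [NormedRing 𝔸] [NormedAlgebra ℂ 𝔸] {a : ℕ → 𝔸} {M ρ : ℝ}
    (ha : ∀ j, ‖a j‖ ≤ M * ρ ^ j) (hM : 0 ≤ M) (hMρ : M ≤ ρ) (k : ℕ) :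
    ‖odeCoeff a k‖ ≤ ‖(1 : 𝔸)‖ * ρ ^ k := by
  have hρ : 0 ≤ ρ := hM.trans hMρ
  induction k using Nat.strong_induction_on with
  | _ k ih =>
    cases k with
    | zero => rw [odeCoeff]; simp
    | succ k =>
      rw [odeCoeff, norm_smul, norm_inv, Complex.norm_natCast, inv_mul_le_iff₀ (by positivity)]
      calc ‖∑ j : Fin (k + 1), a (k - j) * odeCoeff a j‖
          ≤ ∑ _ : Fin (k + 1), ‖(1 : 𝔸)‖ * ρ ^ (k + 1) := by
            refine norm_sum_le_of_le _ fun j _ => ?_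
            have hj : (k - j : ℕ) + j = k := Nat.sub_add_cancel (Nat.lt_succ_iff.1 j.2)
            calc ‖a (k - j) * odeCoeff a j‖ ≤ ‖a (k - j)‖ * ‖odeCoeff a j‖ := norm_mul_le _ _
              _ ≤ (M * ρ ^ (k - j : ℕ)) * (‖(1 : 𝔸)‖ * ρ ^ (j : ℕ)) := by
                gcongr
                · exact ha _
                · exact ih _ j.2
              _ = M * (‖(1 : 𝔸)‖ * (ρ ^ (k - j : ℕ) * ρ ^ (j : ℕ))) := by ring
              _ = M * (‖(1 : 𝔸)‖ * ρ ^ k) := by rw [← pow_add, hj]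
              _ ≤ ρ * (‖(1 : 𝔸)‖ * ρ ^ k) := by gcongr
              _ = _ := by ring
        _ = _ := by simp

theorem exists_hasFPowerSeriesAt_coeff_eq {W : Type*} [NormedAddCommGroup W] [NormedSpace ℂ W]
    [CompleteSpace W] {c : ℕ → W} {C ρ : ℝ} (hρ : 0 < ρ) (hc : ∀ k, ‖c k‖ ≤ C * ρ ^ k) (z₀ : ℂ) :
    ∃ (f : ℂ → W) (p : FormalMultilinearSeries ℂ ℂ W),
      HasFPowerSeriesAt f p z₀ ∧ ∀ k, p.coeff k = c k := by
  let p : FormalMultilinearSeries ℂ ℂ W := fun n =>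
    ContinuousMultilinearMap.mkPiRing ℂ (Fin n) (c n)
  have hr : (ρ⁻¹.toNNReal : ENNReal) ≤ p.radius := p.le_radius_of_bound C fun n => by
    rw [Real.coe_toNNReal _ (inv_nonneg.2 hρ.le), inv_pow, mul_inv_le_iff₀ (pow_pos hρ n)]
    simpa only [p, ContinuousMultilinearMap.norm_mkPiRing] using hc n
  have hpos : 0 < p.radius := lt_of_lt_of_le (by simpa using hρ) hr
  refine ⟨fun z => p.sum (z - z₀), p, ?_, fun k => ?_⟩
  · simpa using ((p.hasFPowerSeriesOnBall hpos).comp_sub z₀).hasFPowerSeriesAt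
  · simp [p, FormalMultilinearSeries.coeff]

theorem eventually_hasSum_deriv {W : Type*} [NormedAddCommGroup W] [NormedSpace ℂ W]
    [CompleteSpace W] {f : ℂ → W} {p : FormalMultilinearSeries ℂ ℂ W} {z₀ : ℂ}
    (hf : HasFPowerSeriesAt f p z₀) :
    ∀ᶠ w in 𝓝 0, HasSum (fun n => w ^ n • ((n + 1) • p.coeff (n + 1))) (deriv f (z₀ + w)) := by
  obtain ⟨r, hr⟩ := hf
  filter_upwards [hasFPowerSeriesAt_iff.1 hr.fderiv.hasFPowerSeriesAt] with w hw
  have h := (ContinuousLinearMap.apply ℂ W (1 : ℂ)).hasSum hw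
  simp only [ContinuousLinearMap.apply_apply, smul_apply, p.derivSeries_coeff_one] at h
  exact h

theorem eventually_hasSum_mul {𝔸 : Type*} [NormedRing 𝔸] [NormedAlgebra ℂ 𝔸] [CompleteSpace 𝔸]
    {f g : ℂ → 𝔸} {p q : FormalMultilinearSeries ℂ ℂ 𝔸} {z₀ : ℂ}
    (hf : HasFPowerSeriesAt f p z₀) (hg : HasFPowerSeriesAt g q z₀) :
    ∀ᶠ w in 𝓝 0, HasSum (fun n => w ^ n •
      ∑ k ∈ Finset.HasAntidiagonal.antidiagonal n, p.coeff k.1 * q.coeff k.2)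
        (f (z₀ + w) * g (z₀ + w)) := by
  obtain ⟨r, hr⟩ := hf
  obtain ⟨r', hr'⟩ := hg
  filter_upwards [hasFPowerSeriesAt_iff.1 hr.hasFPowerSeriesAt,
    hasFPowerSeriesAt_iff.1 hr'.hasFPowerSeriesAt, Metric.eball_mem_nhds (0 : ℂ) hr.r_pos,
    Metric.eball_mem_nhds (0 : ℂ) hr'.r_pos] with w hfw hgw hw hw'
  have hp : Summable fun n => ‖w ^ n • p.coeff n‖ := by
    simpa using p.summable_norm_apply (Metric.eball_subset_eball hr.r_le hw)
  have hq : Summable fun n => ‖w ^ n • q.coeff n‖ := by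
    simpa using q.summable_norm_apply (Metric.eball_subset_eball hr'.r_le hw')
  have hsum := (summable_norm_sum_mul_antidiagonal_of_summable_norm hp hq).of_norm.hasSum
  rw [← tsum_mul_tsum_eq_tsum_sum_antidiagonal_of_summable_norm hp hq, hfw.tsum_eq,
    hgw.tsum_eq] at hsum
  refine hsum.congr_fun fun n => ?_
  rw [Finset.smul_sum]
  refine Finset.sum_congr rfl fun k hk => ?_
  rw [smul_mul_smul_comm, ← pow_add, Finset.HasAntidiagonal.mem_antidiagonal.1 hk]

theorem exists_analyticAt_deriv_eq_mul {𝔸 : Type*} [NormedRing 𝔸] [NormedAlgebra ℂ 𝔸]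
    [CompleteSpace 𝔸] {A : ℂ → 𝔸} {z₀ : ℂ} (hA : AnalyticAt ℂ A z₀) :
    ∃ Y : ℂ → 𝔸, AnalyticAt ℂ Y z₀ ∧ Y z₀ = 1 ∧ ∀ᶠ z in 𝓝 z₀, deriv Y z = A z * Y z := by
  obtain ⟨p, hp⟩ := hA
  obtain ⟨C, r, hC, hr, hCr⟩ := p.le_mul_pow_of_radius_pos hp.radius_pos
  have ha : ∀ j, ‖p.coeff j‖ ≤ C * max C r ^ j := fun j => by
    rw [← p.norm_apply_eq_norm_coef]
    exact (hCr j).trans (by gcongr; exact le_max_right _ _)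
  obtain ⟨Y, q, hq, hqc⟩ := exists_hasFPowerSeriesAt_coeff_eq (lt_max_of_lt_left hC)
    (norm_odeCoeff_le ha hC.le (le_max_left _ _)) z₀
  refine ⟨Y, hq.analyticAt, ?_, ?_⟩
  · rw [← hq.coeff_zero 1]
    exact (hqc 0).trans (by rw [odeCoeff])
  · have hsub : Tendsto (fun z => z - z₀) (𝓝 z₀) (𝓝 0) := by
      simpa using (continuous_sub_right z₀).tendsto z₀
    filter_upwards [hsub.eventually (eventually_hasSum_deriv hq),
      hsub.eventually (eventually_hasSum_mul hp hq)] with z hd hm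
    rw [add_sub_cancel] at hd hm
    simp only [hqc, succ_smul_odeCoeff] at hd hm
    exact hd.unique hm

theorem exists_analyticAt_linear_system {ι : Type*} [Fintype ι] {a : ι → ι → ℂ → ℂ} {z₀ : ℂ}
    (ha : ∀ i j, AnalyticAt ℂ (a i j) z₀) (v : ι → ℂ) :
    ∃ u : ι → ℂ → ℂ, (∀ i, AnalyticAt ℂ (u i) z₀) ∧ (∀ i, u i z₀ = v i) ∧
      ∀ᶠ z in 𝓝 z₀, ∀ i, deriv (u i) z = ∑ j, a i j z * u j z := by
  classical
  let unit (i j : ι) : (ι → ℂ) →L[ℂ] (ι → ℂ) :=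
    (ContinuousLinearMap.proj j).smulRight (Pi.single i 1)
  let A : ℂ → (ι → ℂ) →L[ℂ] (ι → ℂ) := fun z => ∑ i, ∑ j, a i j z • unit i j
  have hA : AnalyticAt ℂ A z₀ := Finset.analyticAt_fun_sum _ fun i _ =>
    Finset.analyticAt_fun_sum _ fun j _ => (ha i j).smul analyticAt_const
  obtain ⟨Y, hY, hY₀, hYA⟩ := exists_analyticAt_deriv_eq_mul hA
  let eval (i : ι) : ((ι → ℂ) →L[ℂ] (ι → ℂ)) →L[ℂ] ℂ :=
    ContinuousLinearMap.proj i ∘L ContinuousLinearMap.apply ℂ (ι → ℂ) v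
  refine ⟨fun i z => eval i (Y z), fun i => ((eval i).analyticAt _).comp hY,
    fun i => by simp [eval, hY₀], ?_⟩
  filter_upwards [hY.eventually_analyticAt, hYA] with z hz hYz i
  have hderiv := (eval i).hasFDerivAt.comp_hasDerivAt z hz.differentiableAt.hasDerivAt
  rw [show (fun z => eval i (Y z)) = eval i ∘ Y from rfl, hderiv.deriv, hYz]
  simp [eval, A, unit, Pi.single_apply]

end ODE

section HolFunctions

variable {X : Type*} [TopologicalSpace X] [ChartedSpace ℂ X]

theorem HolAt.congr {g g' : X → ℂ} {x : X} (hg : HolAt g x) (h : ∀ᶠ y in 𝓝 x, g' y = g y) :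
    HolAt g' x :=
  ContMDiffAt.congr_of_eventuallyEq hg h

theorem HolAt.sum {ι : Type*} {s : Finset ι} {g : ι → X → ℂ} {x : X} (h : ∀ i ∈ s, HolAt (g i) x) :
    HolAt (fun y => ∑ i ∈ s, g i y) x :=
  contMDiffAt_finsetSum h

theorem HolAt.prod {ι : Type*} {s : Finset ι} {g : ι → X → ℂ} {x : X}
    (h : ∀ i ∈ s, HolAt (g i) x) : HolAt (fun y => ∏ i ∈ s, g i y) x :=
  contMDiffAt_finsetProd h

theorem HolAt.mul {g g' : X → ℂ} {x : X} (h : HolAt g x) (h' : HolAt g' x) :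
    HolAt (fun y => g y * g' y) x :=
  ContMDiffAt.mul h h'

theorem holAt_const (c : ℂ) (x : X) : HolAt (fun _ => c) x :=
  contMDiffAt_const

theorem HolAt.mdifferentiableAt {g : X → ℂ} {x : X} (h : HolAt g x) :
    MDifferentiableAt 𝓘(ℂ, ℂ) 𝓘(ℂ, ℂ) g x :=
  ContMDiffAt.mdifferentiableAt h (by simp)

theorem HolAt.inv {g : X → ℂ} {x : X} (h : HolAt g x) (h0 : g x ≠ 0) :
    HolAt (fun y => (g y)⁻¹) x :=
  ContMDiffAt.inv₀ h h0

theorem holAt_det {ι : Type*} [Fintype ι] [DecidableEq ι] {M : X → Matrix ι ι ℂ} {x : X}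
    (hM : ∀ i j, HolAt (fun y => M y i j) x) : HolAt (fun y => (M y).det) x := by
  simp only [Matrix.det_apply']
  exact HolAt.sum fun σ _ => (holAt_const _ _).mul (HolAt.prod fun i _ => hM _ _)

theorem holAt_of_mulVec_eq {ι : Type*} [Fintype ι] [DecidableEq ι] {M : X → Matrix ι ι ℂ}
    {u c : X → ι → ℂ} {x : X} (hM : ∀ i j, HolAt (fun y => M y i j) x)
    (hc : ∀ i, HolAt (fun y => c y i) x) (hdet : (M x).det ≠ 0)
    (h : ∀ᶠ y in 𝓝 x, (M y).mulVec (u y) = c y) (i : ι) : HolAt (fun y => u y i) x := by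
  have hd := holAt_det hM
  have hnum : HolAt (fun y => ((M y).updateCol i (c y)).det) x := by
    refine holAt_det fun a b => ?_
    simp only [Matrix.updateCol_apply]
    split_ifs
    · exact hc a
    · exact hM a b
  refine ((hd.inv hdet).mul hnum).congr ?_
  filter_upwards [h, hd.continuousAt.eventually_ne hdet] with y hy hy0
  have hcramer : (M y).cramer (c y) = (M y).det • u y := by
    rw [← hy, Matrix.cramer_eq_adjugate_mulVec, Matrix.mulVec_mulVec, Matrix.adjugate_mul,
      Matrix.smul_mulVec, Matrix.one_mulVec]
  have hcol := congrFun hcramer i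
  rw [Matrix.cramer_apply] at hcol
  rw [hcol]
  simp [hy0]

theorem eventually_mem_chart_source (x : X) : ∀ᶠ y in 𝓝 x, y ∈ (chartAt ℂ x).source :=
  (chartAt ℂ x).open_source.mem_nhds (mem_chart_source ℂ x)

theorem mvfderiv_congr {g g' : X → ℂ} {x : X} (h : g' =ᶠ[𝓝 x] g) :
    mvfderiv 𝓘(ℂ, ℂ) g' x = mvfderiv 𝓘(ℂ, ℂ) g x := by
  unfold mvfderiv
  rw [h.mfderiv_eq, h.eq_of_nhds]

theorem tendsto_chartAt (x : X) : Tendsto (chartAt ℂ x) (𝓝 x) (𝓝 (chartAt ℂ x x)) :=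
  (chartAt ℂ x).continuousAt (mem_chart_source ℂ x)

theorem tendsto_chartAt_symm {x y : X} (hy : y ∈ (chartAt ℂ x).source) :
    Tendsto (chartAt ℂ x).symm (𝓝 (chartAt ℂ x y)) (𝓝 y) := by
  have := (chartAt ℂ x).continuousAt_symm ((chartAt ℂ x).map_source hy)
  rwa [ContinuousAt, (chartAt ℂ x).left_inv hy] at this

variable [IsManifold 𝓘(ℂ, ℂ) ω X]

theorem holAt_iff_analyticAt {g : X → ℂ} {x y : X} (hy : y ∈ (chartAt ℂ x).source) :
    HolAt g y ↔ AnalyticAt ℂ (g ∘ (chartAt ℂ x).symm) (chartAt ℂ x y) := by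
  rw [HolAt, contMDiffAt_iff_source_of_mem_source hy]
  simp only [mfld_simps, contMDiffWithinAt_univ, contMDiffAt_iff_contDiffAt]
  exact ⟨fun h => h.analyticAt, fun h => h.contDiffAt⟩

/-- The holomorphic tangent vector field `d/dz` near `x`, where `z` is the preferred chart
at `x`. -/
def dz (x y : X) : TangentSpace 𝓘(ℂ, ℂ) y :=
  (trivializationAt ℂ (TangentSpace 𝓘(ℂ, ℂ)) x).symmL ℂ y (1 : ℂ)

theorem mvfderiv_dz {g : X → ℂ} {x y : X} (hy : y ∈ (chartAt ℂ x).source)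
    (hg : MDifferentiableAt 𝓘(ℂ, ℂ) 𝓘(ℂ, ℂ) g y) :
    mvfderiv 𝓘(ℂ, ℂ) g y (dz x y) = deriv (g ∘ (chartAt ℂ x).symm) (chartAt ℂ x y) := by
  obtain ⟨w, hw, rfl⟩ : ∃ w ∈ (chartAt ℂ x).target, (chartAt ℂ x).symm w = y :=
    ⟨_, (chartAt ℂ x).map_source hy, (chartAt ℂ x).left_inv hy⟩
  have hs : MDifferentiableAt 𝓘(ℂ, ℂ) 𝓘(ℂ, ℂ) (chartAt ℂ x).symm w :=
    mdifferentiableAt_atlas_symm (chart_mem_atlas ℂ x) hw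
  have hinv : chartAt ℂ x ((chartAt ℂ x).symm w) = w := (chartAt ℂ x).right_inv hw
  have hdz : dz x ((chartAt ℂ x).symm w) =
      mfderiv 𝓘(ℂ, ℂ) 𝓘(ℂ, ℂ) (chartAt ℂ x).symm w (1 : ℂ) := by
    rw [dz, TangentBundle.symmL_trivializationAt hy]
    have hcongr : ∀ w' : ℂ, w' = w →
        (mfderiv 𝓘(ℂ, ℂ) 𝓘(ℂ, ℂ) (chartAt ℂ x).symm w' (1 : ℂ) : ℂ) =
          mfderiv 𝓘(ℂ, ℂ) 𝓘(ℂ, ℂ) (chartAt ℂ x).symm w (1 : ℂ) := by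
      rintro _ rfl
      rfl
    simp only [mfld_simps, mfderivWithin_univ]
    exact hcongr _ hinv
  have hderiv : mvfderiv 𝓘(ℂ, ℂ) (g ∘ (chartAt ℂ x).symm) w (1 : ℂ) =
      deriv (g ∘ (chartAt ℂ x).symm) w := by
    rw [mvfderiv, mfderiv_eq_fderiv]
    rfl
  rw [hinv, ← hderiv, mvfderiv_comp w hg hs, hdz]
  rfl

theorem exists_eq_smul_dz {x y : X} (hy : y ∈ (chartAt ℂ x).source)
    (v : TangentSpace 𝓘(ℂ, ℂ) y) : ∃ c : ℂ, v = c • dz x y := by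
  have hy' : y ∈ (trivializationAt ℂ (TangentSpace 𝓘(ℂ, ℂ)) x).baseSet := by simpa using hy
  refine ⟨(trivializationAt ℂ (TangentSpace 𝓘(ℂ, ℂ)) x).continuousLinearMapAt ℂ y v, ?_⟩
  rw [dz, ← map_smul, smul_eq_mul, mul_one,
    Trivialization.symmL_continuousLinearMapAt _ hy']

theorem holAt_comp_chart {h : ℂ → ℂ} {x y : X} (hy : y ∈ (chartAt ℂ x).source)
    (hh : AnalyticAt ℂ h (chartAt ℂ x y)) : HolAt (fun y => h (chartAt ℂ x y)) y := by
  rw [holAt_iff_analyticAt hy]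
  refine hh.congr ?_
  filter_upwards [(chartAt ℂ x).open_target.mem_nhds ((chartAt ℂ x).map_source hy)] with z hz
  simp [(chartAt ℂ x).right_inv hz]

theorem mvfderiv_comp_chart {h : ℂ → ℂ} {x y : X} (hy : y ∈ (chartAt ℂ x).source)
    (hh : AnalyticAt ℂ h (chartAt ℂ x y)) :
    mvfderiv 𝓘(ℂ, ℂ) (fun y => h (chartAt ℂ x y)) y (dz x y) = deriv h (chartAt ℂ x y) := by
  rw [mvfderiv_dz hy (holAt_comp_chart hy hh).mdifferentiableAt]
  refine EventuallyEq.deriv_eq ?_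
  filter_upwards [(chartAt ℂ x).open_target.mem_nhds ((chartAt ℂ x).map_source hy)] with z hz
  simp [(chartAt ℂ x).right_inv hz]

end HolFunctions

section HolSections

variable {X : Type*} [TopologicalSpace X] [ChartedSpace ℂ X]
  {F : Type*} [NormedAddCommGroup F] [NormedSpace ℂ F]
  {E : X → Type*} [TopologicalSpace (TotalSpace F E)]
  [∀ x, AddCommGroup (E x)] [∀ x, Module ℂ (E x)] [∀ x, TopologicalSpace (E x)]
  [FiberBundle F E] [VectorBundle ℂ F E]

theorem holGerms_congr {s t : Π y, E y} {x : X} (hs : s ∈ holGerms F x)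
    (h : ∀ᶠ y in 𝓝 x, t y = s y) : t ∈ holGerms F x :=
  ContMDiffAt.congr_of_eventuallyEq hs (h.mono fun y hy => congrArg (TotalSpace.mk' F y) hy)

theorem smul_mem_holGerms {g : X → ℂ} {s : Π y, E y} {x : X} (hg : HolAt g x)
    (hs : s ∈ holGerms F x) : (fun y => g y • s y) ∈ holGerms F x :=
  ContMDiffAt.smul_section hg hs

theorem sum_smul_mem_holGerms {ι : Type*} {t : Finset ι} {g : ι → X → ℂ} {s : ι → Π y, E y} {x : X}
    (hg : ∀ i ∈ t, HolAt (g i) x) (hs : ∀ i ∈ t, s i ∈ holGerms F x) :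
    (fun y => ∑ i ∈ t, g i y • s i y) ∈ holGerms F x := by
  convert Submodule.sum_mem (holGerms F x) fun i hi => smul_mem_holGerms (hg i hi) (hs i hi) using 1
  exact funext fun y => by rw [Finset.sum_apply]

theorem mdifferentiableAt_of_mem_holGerms {s : Π y, E y} {x : X} (hs : s ∈ holGerms F x) :
    MDifferentiableAt 𝓘(ℂ, ℂ) (𝓘(ℂ, ℂ).prod 𝓘(ℂ, F)) (fun y => TotalSpace.mk' F y (s y)) x :=
  ContMDiffAt.mdifferentiableAt hs (by simp)

theorem holAt_pairing {φ : Π y, Dual E y} {s : Π y, E y} {x : X}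
    (hφ : φ ∈ holGerms (F →L[ℂ] ℂ) x) (hs : s ∈ holGerms F x) :
    HolAt (fun y => (φ y (s y) : ℂ)) x :=
  (contMDiffAt_section (E := Trivial X ℂ) x).1 (ContMDiffAt.clm_bundle_apply hφ hs)

end HolSections

section Fibers

variable {X : Type*} [TopologicalSpace X]
  (F : Type*) [NormedAddCommGroup F] [NormedSpace ℂ F]
  {E : X → Type*} [TopologicalSpace (TotalSpace F E)]
  [∀ x, AddCommGroup (E x)] [∀ x, Module ℂ (E x)] [∀ x, TopologicalSpace (E x)]

theorem t2Space_fiber [FiberBundle F E] [VectorBundle ℂ F E] (x : X) : T2Space (E x) :=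
  ((trivializationAt F E x).continuousLinearEquivAt ℂ x
    (FiberBundle.mem_baseSet_trivializationAt' x)).symm.toHomeomorph.t2Space

variable [FiberBundle F E] [VectorBundle ℂ F E]

theorem finiteDimensional_fiber [FiniteDimensional ℂ F] (x : X) : FiniteDimensional ℂ (E x) :=
  ((trivializationAt F E x).linearEquivAt ℂ x
    (FiberBundle.mem_baseSet_trivializationAt' x)).symm.finiteDimensional

theorem finrank_fiber (x : X) : Module.finrank ℂ (E x) = Module.finrank ℂ F :=
  ((trivializationAt F E x).linearEquivAt ℂ x
    (FiberBundle.mem_baseSet_trivializationAt' x)).finrank_eq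

end Fibers

section HolBundles

variable {X : Type*} [TopologicalSpace X] [ChartedSpace ℂ X]
  {F : Type*} [NormedAddCommGroup F] [NormedSpace ℂ F]
  {E : X → Type*} [TopologicalSpace (TotalSpace F E)]
  [∀ x, AddCommGroup (E x)] [∀ x, Module ℂ (E x)] [∀ x, TopologicalSpace (E x)]
  [FiberBundle F E] [VectorBundle ℂ F E]

variable (F) in
theorem exists_mem_holGerms {x : X} (v : E x) : ∃ s ∈ holGerms F x, s x = v :=
  ⟨FiberBundle.extend F v, FiberBundle.contMDiffAt_extend .., by simp⟩

variable [ContMDiffVectorBundle ω F E 𝓘(ℂ, ℂ)]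

theorem symmL_mem_holGerms (x : X) (w : F) :
    (fun y => (trivializationAt F E x).symmL ℂ y w) ∈ holGerms F x := by
  let T := trivializationAt F E x
  have hx : x ∈ T.baseSet := FiberBundle.mem_baseSet_trivializationAt' x
  refine (T.contMDiffAt_section_iff hx).2 ?_
  refine (contMDiffAt_const (c := w)).congr_of_eventuallyEq ?_
  filter_upwards [T.open_baseSet.mem_nhds hx] with y hy
  have := T.continuousLinearMapAt_symmL (R := ℂ) hy w
  rwa [Trivialization.continuousLinearMapAt_apply, Trivialization.coe_linearMapAt_of_mem T hy]
    at this

theorem eventually_mem_holGerms [IsManifold 𝓘(ℂ, ℂ) ω X] {s : Π y, E y} {x : X}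
    (hs : s ∈ holGerms F x) : ∀ᶠ y in 𝓝 x, s ∈ holGerms F y :=
  (contMDiffAt_iff_contMDiffAt_nhds (by simp)).1 hs

end HolBundles

section Frames

variable {X : Type*} [TopologicalSpace X] [ChartedSpace ℂ X]
  {F : Type*} [NormedAddCommGroup F] [NormedSpace ℂ F]
  {E : X → Type*} [TopologicalSpace (TotalSpace F E)]
  [∀ x, AddCommGroup (E x)] [∀ x, Module ℂ (E x)] [∀ x, TopologicalSpace (E x)]
  [FiberBundle F E] [VectorBundle ℂ F E]

variable (F) in
/-- `e` is a holomorphic frame near `x` of the family `V` of subspaces of `E`. Independence is only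
asked for at `x`, from where it spreads to nearby points. -/
structure IsFrameAt {ι : Type*} (x : X) (V : ∀ y, Submodule ℂ (E y)) (e : ι → Π y, E y) :
    Prop where
  mem : ∀ i, e i ∈ holGerms F x
  linearIndependent : LinearIndependent ℂ fun i => e i x
  span_eq : ∀ᶠ y in 𝓝 x, Submodule.span ℂ (Set.range fun i => e i y) = V y

theorem IsHolSubbundle.exists_isFrameAt {V : ∀ y, Submodule ℂ (E y)} (hV : IsHolSubbundle F V)
    (x : X) : ∃ (r : ℕ) (e : Fin r → Π y, E y), IsFrameAt F x V e := by
  obtain ⟨r, e, he, h⟩ := hV x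
  exact ⟨r, e, he, h.self_of_nhds.1, h.mono fun y hy => hy.2⟩

theorem IsFrameAt.eventually_mem_subspace {ι : Type*} {x : X} {V : ∀ y, Submodule ℂ (E y)}
    {e : ι → Π y, E y} (h : IsFrameAt F x V e) : ∀ᶠ y in 𝓝 x, ∀ i, e i y ∈ V y :=
  h.span_eq.mono fun _ hy i => hy ▸ Submodule.subset_span ⟨i, rfl⟩

variable [FiniteDimensional ℂ F] [∀ x, IsTopologicalAddGroup (E x)] [∀ x, ContinuousSMul ℂ (E x)]
  {ι : Type*} {x : X}

theorem exists_dual_sections [Finite ι] [DecidableEq ι] {v : ι → E x} (hv : LinearIndependent ℂ v) :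
    ∃ φ : ι → Π y, Dual E y, (∀ i, φ i ∈ holGerms (F →L[ℂ] ℂ) x) ∧
      ∀ i j, (φ i x (v j) : ℂ) = (1 : Matrix ι ι ℂ) i j := by
  cases nonempty_fintype ι
  have := finiteDimensional_fiber F (E := E) x
  have := t2Space_fiber F (E := E) x
  obtain ⟨g, hg⟩ := LinearMap.exists_leftInverse_of_injective (Fintype.linearCombination ℂ v)
    (LinearMap.ker_eq_bot.2 hv.fintypeLinearCombination_injective)
  choose φ hφ hφx using fun i => exists_mem_holGerms (F →L[ℂ] ℂ) (E := Dual E) (x := x)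
    (LinearMap.toContinuousLinearMap (LinearMap.proj i ∘ₗ g))
  refine ⟨φ, hφ, fun i j => ?_⟩
  have hgj := congrFun (LinearMap.congr_fun hg (Pi.single j 1)) i
  simp only [LinearMap.coe_comp, Function.comp_apply, Fintype.linearCombination_apply_single,
    one_smul, LinearMap.id_coe, id_eq, Pi.single_apply] at hgj
  rw [hφx, Matrix.one_apply, ← hgj]
  rfl

variable {e : ι → Π y, E y}

theorem eventually_linearIndependent [Finite ι] (he : ∀ i, e i ∈ holGerms F x)
    (hli : LinearIndependent ℂ fun i => e i x) :
    ∀ᶠ y in 𝓝 x, LinearIndependent ℂ fun i => e i y := by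
  classical
  cases nonempty_fintype ι
  obtain ⟨φ, hφ, hφe⟩ := exists_dual_sections (F := F) hli
  let M : X → Matrix ι ι ℂ := fun y => Matrix.of fun i j => (φ i y (e j y) : ℂ)
  have hM : HolAt (fun y => (M y).det) x := holAt_det fun i j => holAt_pairing (hφ i) (he j)
  have hMx : (M x).det ≠ 0 := by
    rw [show M x = 1 from Matrix.ext hφe, Matrix.det_one]
    exact one_ne_zero
  filter_upwards [hM.continuousAt.eventually_ne hMx] with y hy
  rw [Fintype.linearIndependent_iff]
  intro g hg
  refine congrFun (Matrix.eq_zero_of_mulVec_eq_zero hy (funext fun i => ?_))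
  have hφg : (φ i y (∑ j, g j • e j y) : ℂ) = 0 := by
    rw [hg]
    exact map_zero (φ i y)
  simpa [M, Matrix.mulVec, dotProduct, mul_comm] using hφg

theorem holAt_coeff [Fintype ι] (he : ∀ i, e i ∈ holGerms F x)
    (hli : LinearIndependent ℂ fun i => e i x) {s : Π y, E y} (hs : s ∈ holGerms F x)
    {u : X → ι → ℂ}
    (hu : ∀ᶠ y in 𝓝 x, s y = ∑ i, u y i • e i y) (i : ι) : HolAt (fun y => u y i) x := by
  classical
  obtain ⟨φ, hφ, hφe⟩ := exists_dual_sections (F := F) hli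
  refine holAt_of_mulVec_eq (M := fun y => Matrix.of fun i j => (φ i y (e j y) : ℂ))
    (c := fun y i => (φ i y (s y) : ℂ)) (fun i j => holAt_pairing (hφ i) (he j))
    (fun i => holAt_pairing (hφ i) hs) ?_ ?_ i
  · rw [show Matrix.of (fun i j => (φ i x (e j x) : ℂ)) = 1 from Matrix.ext hφe, Matrix.det_one]
    exact one_ne_zero
  · filter_upwards [hu] with y hy
    ext i
    simp [hy, Matrix.mulVec, dotProduct, mul_comm]

theorem isHolSubbundle_of_isFrameAt {V : ∀ y, Submodule ℂ (E y)}
    (h : ∀ x, ∃ (ι : Type) (_ : Finite ι) (e : ι → Π y, E y), IsFrameAt F x V e) :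
    IsHolSubbundle F V := by
  intro x
  obtain ⟨ι, _, e, he⟩ := h x
  cases nonempty_fintype ι
  let q := (Fintype.equivFin ι).symm
  refine ⟨Fintype.card ι, fun i => e (q i), fun i => he.mem _, ?_⟩
  filter_upwards [eventually_linearIndependent he.mem he.linearIndependent, he.span_eq]
    with y hli hspan
  exact ⟨hli.comp _ q.injective, by rw [← hspan, ← q.surjective.range_comp fun i => e i y]; rfl⟩

theorem isFrameAt_top [Finite ι] (he : ∀ i, e i ∈ holGerms F x)
    (hli : LinearIndependent ℂ fun i => e i x)
    (hspan : Submodule.span ℂ (Set.range fun i => e i x) = ⊤) :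
    IsFrameAt F x (fun _ => ⊤) e where
  mem := he
  linearIndependent := hli
  span_eq := by
    cases nonempty_fintype ι
    have hcard : Fintype.card ι = Module.finrank ℂ F :=
      (Module.finrank_eq_card_basis (Module.Basis.mk hli hspan.ge)).symm.trans (finrank_fiber F x)
    filter_upwards [eventually_linearIndependent he hli] with y hy
    have := finiteDimensional_fiber F (E := E) y
    exact hy.span_eq_top_of_card_eq_finrank' (hcard.trans (finrank_fiber F y).symm)

variable (F x) in
theorem exists_isFrameAt_top : ∃ (r : ℕ) (e : Fin r → Π y, E y), IsFrameAt F x (fun _ => ⊤) e := by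
  have := finiteDimensional_fiber F (E := E) x
  let b := Module.finBasis ℂ (E x)
  choose e he hex using fun i => exists_mem_holGerms F (b i)
  exact ⟨_, e, isFrameAt_top he (by simpa only [hex] using b.linearIndependent)
    (by simpa only [hex] using b.span_eq)⟩

namespace IsFrameAt

variable {V : ∀ y, Submodule ℂ (E y)}

theorem eventually_linearIndependent [Finite ι] (h : IsFrameAt F x V e) :
    ∀ᶠ y in 𝓝 x, LinearIndependent ℂ fun i => e i y :=
  Quasioper.eventually_linearIndependent h.mem h.linearIndependent

theorem eventually_isFrameAt [Finite ι] [IsManifold 𝓘(ℂ, ℂ) ω X]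
    [ContMDiffVectorBundle ω F E 𝓘(ℂ, ℂ)] (h : IsFrameAt F x V e) :
    ∀ᶠ y in 𝓝 x, IsFrameAt F y V e := by
  filter_upwards [eventually_all.2 fun i => eventually_mem_holGerms (h.mem i),
    h.eventually_linearIndependent, h.span_eq.eventually_nhds] with y h₁ h₂ h₃
  exact ⟨h₁, h₂, h₃⟩

theorem exists_coeff [Fintype ι] (h : IsFrameAt F x V e) {s : Π y, E y} (hs : s ∈ holGerms F x)
    (hsV : ∀ᶠ y in 𝓝 x, s y ∈ V y) :
    ∃ u : ι → X → ℂ, (∀ i, HolAt (u i) x) ∧ ∀ᶠ y in 𝓝 x, s y = ∑ i, u i y • e i y := by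
  have hspan : ∀ᶠ y in 𝓝 x, ∃ c : ι → ℂ, s y = ∑ i, c i • e i y := by
    filter_upwards [hsV, h.span_eq] with y hy hVy
    obtain ⟨c, hc⟩ := (Submodule.mem_span_range_iff_exists_fun ℂ).1 (hVy ▸ hy)
    exact ⟨c, hc.symm⟩
  obtain ⟨u, hu⟩ := hspan.choice
  exact ⟨fun i y => u y i, holAt_coeff h.mem h.linearIndependent hs hu, hu⟩

end IsFrameAt

end Frames

section Connections

variable {X : Type*} [TopologicalSpace X] [ChartedSpace ℂ X]
  {F : Type*} [NormedAddCommGroup F] [NormedSpace ℂ F]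
  {E : X → Type*} [TopologicalSpace (TotalSpace F E)]
  [∀ x, AddCommGroup (E x)] [∀ x, Module ℂ (E x)] [∀ x, TopologicalSpace (E x)]
  [∀ x, IsTopologicalAddGroup (E x)] [∀ x, ContinuousSMul ℂ (E x)]
  [FiberBundle F E] [VectorBundle ℂ F E] {D : CovariantDerivative 𝓘(ℂ, ℂ) F E}

theorem connection_smul {g : X → ℂ} {s : Π y, E y} {x : X} (hg : HolAt g x)
    (hs : s ∈ holGerms F x) (v : TangentSpace 𝓘(ℂ, ℂ) x) :
    D (fun y => g y • s y) x v = g x • D s x v + mvfderiv 𝓘(ℂ, ℂ) g x v • s x :=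
  congrArg (fun L => L v) (D.isCovariantDerivativeOnUniv.leibniz
    (mdifferentiableAt_of_mem_holGerms hs) hg.mdifferentiableAt)

theorem connection_add {s t : Π y, E y} {x : X} (hs : s ∈ holGerms F x) (ht : t ∈ holGerms F x)
    (v : TangentSpace 𝓘(ℂ, ℂ) x) : D (s + t) x v = D s x v + D t x v :=
  congrArg (fun L => L v) (D.isCovariantDerivativeOnUniv.add
    (mdifferentiableAt_of_mem_holGerms hs) (mdifferentiableAt_of_mem_holGerms ht))

theorem connection_congr {s t : Π y, E y} {x : X} (hs : s ∈ holGerms F x)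
    (h : ∀ᶠ y in 𝓝 x, t y = s y) (v : TangentSpace 𝓘(ℂ, ℂ) x) : D t x v = D s x v := by
  classical
  -- `D` is only additive and Leibniz, so locality comes from a function `g` which is `1` near `x`
  -- and satisfies `g t = g s` everywhere
  let g : X → ℂ := fun y => if t y = s y then 1 else 0
  have hg : g =ᶠ[𝓝 x] fun _ => 1 := h.mono fun y hy => by simp [g, hy]
  have hgt : (fun y => g y • t y) = fun y => g y • s y := by
    ext y
    by_cases hy : t y = s y <;> simp [g, hy]
  have hsmul : ∀ {r : Π y, E y}, r ∈ holGerms F x → D (fun y => g y • r y) x v = D r x v := by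
    intro r hr
    rw [connection_smul ((holAt_const 1 x).congr hg) hr, mvfderiv_congr hg, mvfderiv_const,
      hg.eq_of_nhds]
    simp
  rw [← hsmul (holGerms_congr hs h), hgt, hsmul hs]

theorem connection_sum_smul {ι : Type*} {A : Finset ι} {g : ι → X → ℂ} {s : ι → Π y, E y} {x : X}
    (hg : ∀ i ∈ A, HolAt (g i) x) (hs : ∀ i ∈ A, s i ∈ holGerms F x)
    (v : TangentSpace 𝓘(ℂ, ℂ) x) :
    D (fun y => ∑ i ∈ A, g i y • s i y) x v =
      ∑ i ∈ A, (g i x • D (s i) x v + mvfderiv 𝓘(ℂ, ℂ) (g i) x v • s i x) := by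
  classical
  induction A using Finset.induction_on with
  | empty =>
    simp only [Finset.sum_empty]
    exact congrFun (congrArg (fun L => (L x : TangentSpace 𝓘(ℂ, ℂ) x → E x)) D.zero) v
  | insert a A ha ih =>
    simp only [Finset.forall_mem_insert] at hg hs
    rw [Finset.sum_insert ha, ← ih hg.2 hs.2, ← connection_smul hg.1 hs.1 v,
      ← connection_add (smul_mem_holGerms hg.1 hs.1) (sum_smul_mem_holGerms hg.2 hs.2)]
    congr 2
    ext y
    simp [Finset.sum_insert ha]

/-- The fibrewise span of `V` and of the derivatives of its holomorphic sections. It is `Dhat D V`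
as soon as it is a subbundle. -/
def derived (D : CovariantDerivative 𝓘(ℂ, ℂ) F E) (V : ∀ y, Submodule ℂ (E y)) (y : X) :
    Submodule ℂ (E y) :=
  V y ⊔ Submodule.span ℂ
    {w | ∃ t ∈ holGerms F y, (∀ᶠ z in 𝓝 y, t z ∈ V z) ∧ ∃ v, D t y v = w}

theorem Dhat_eq_derived {V : ∀ y, Submodule ℂ (E y)} (h : IsHolSubbundle F (derived D V)) :
    Dhat D V = derived D V := by
  refine le_antisymm (sInf_le ⟨h, fun y => le_sup_left, fun y t ht htV v => ?_⟩)
    (le_sInf fun U ⟨_, hVU, hDU⟩ y => sup_le (hVU y) (Submodule.span_le.2 ?_))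
  · exact Submodule.mem_sup_right (Submodule.subset_span ⟨t, ht, htV, v, rfl⟩)
  · rintro _ ⟨t, ht, htV, v, rfl⟩
    exact hDU y t ht htV v

end Connections

section Nabla

variable {X : Type*} [TopologicalSpace X] [ChartedSpace ℂ X] [IsManifold 𝓘(ℂ, ℂ) ω X]
  {F : Type*} [NormedAddCommGroup F] [NormedSpace ℂ F]
  {E : X → Type*} [TopologicalSpace (TotalSpace F E)]
  [∀ x, AddCommGroup (E x)] [∀ x, Module ℂ (E x)] [∀ x, TopologicalSpace (E x)]
  [∀ x, IsTopologicalAddGroup (E x)] [∀ x, ContinuousSMul ℂ (E x)]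
  [FiberBundle F E] {D : CovariantDerivative 𝓘(ℂ, ℂ) F E}

/-- The covariant derivative in the direction `d/dz`, where `z` is the preferred chart at `x`. -/
def nabla (D : CovariantDerivative 𝓘(ℂ, ℂ) F E) (x : X) (s : Π y, E y) (y : X) : E y :=
  D s y (dz x y)

theorem iterate_nabla_succ (x : X) (s : Π y, E y) (j : ℕ) (y : X) :
    (nabla D x)^[j + 1] s y = D ((nabla D x)^[j] s) y (dz x y) := by
  rw [Function.iterate_succ_apply', nabla]

theorem connection_eq_zero {x y : X} {s : Π y, E y} (hy : y ∈ (chartAt ℂ x).source)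
    (h : nabla D x s y = 0) : D s y = 0 := by
  refine ContinuousLinearMap.ext fun v => ?_
  obtain ⟨c, rfl⟩ := exists_eq_smul_dz hy v
  change D s y (c • dz x y) = 0
  rw [map_smul]
  exact (congrArg (c • ·) h).trans (smul_zero c)

variable [VectorBundle ℂ F E]

theorem nabla_mem_holGerms (hD : IsHolConnection D) {s : Π y, E y} {x : X}
    (hs : s ∈ holGerms F x) : nabla D x s ∈ holGerms F x :=
  ContMDiffAt.clm_bundle_apply (hD x s hs) (symmL_mem_holGerms x (1 : ℂ))

theorem iterate_nabla_mem_holGerms (hD : IsHolConnection D) {s : Π y, E y} {x : X}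
    (hs : s ∈ holGerms F x) (j : ℕ) : (nabla D x)^[j] s ∈ holGerms F x := by
  induction j with
  | zero => exact hs
  | succ j ih => rw [Function.iterate_succ_apply']; exact nabla_mem_holGerms hD ih

variable [ContMDiffVectorBundle ω F E 𝓘(ℂ, ℂ)]

theorem exists_nabla_eq_zero [FiniteDimensional ℂ F] (hD : IsHolConnection D) (x : X) (v : E x) :
    ∃ s ∈ holGerms F x, s x = v ∧ ∀ᶠ y in 𝓝 x, nabla D x s y = 0 := by
  obtain ⟨r, t, ht⟩ := exists_isFrameAt_top F (E := E) x
  have hcoeff := fun j => ht.exists_coeff (nabla_mem_holGerms hD (ht.mem j))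
    (.of_forall fun _ => Submodule.mem_top)
  choose a ha hat using hcoeff
  obtain ⟨c, hc⟩ := (Submodule.mem_span_range_iff_exists_fun ℂ).1
    (ht.span_eq.self_of_nhds ▸ Submodule.mem_top : v ∈ _)
  obtain ⟨u, hu, hu₀, hdu⟩ := exists_analyticAt_linear_system
    (a := fun i j z => -a j i ((chartAt ℂ x).symm z)) (z₀ := chartAt ℂ x x)
    (fun i j => ((holAt_iff_analyticAt (mem_chart_source ℂ x)).1 (ha j i)).neg) c
  refine ⟨fun y => ∑ i, u i (chartAt ℂ x y) • t i y, sum_smul_mem_holGerms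
    (fun i _ => holAt_comp_chart (mem_chart_source ℂ x) (hu i)) fun i _ => ht.mem i,
    by simp only [hu₀, hc], ?_⟩
  filter_upwards [eventually_mem_chart_source x, (tendsto_chartAt x).eventually hdu,
    (tendsto_chartAt x).eventually (eventually_all.2 fun i => (hu i).eventually_analyticAt),
    ht.eventually_isFrameAt, eventually_all.2 hat] with y hy hduy huy hty haty
  rw [nabla, connection_sum_smul (fun i _ => holAt_comp_chart hy (huy i)) fun i _ => hty.mem i]
  simp only [mvfderiv_comp_chart hy (huy _), hduy, (chartAt ℂ x).left_inv hy,
    ← nabla.eq_def D x, haty, Finset.smul_sum, Finset.sum_add_distrib, Finset.sum_smul, smul_smul]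
  rw [Finset.sum_comm, ← Finset.sum_add_distrib]
  refine Finset.sum_eq_zero fun i _ => ?_
  rw [← Finset.sum_add_distrib]
  refine Finset.sum_eq_zero fun j _ => ?_
  rw [← add_smul, neg_mul, mul_comm, add_neg_cancel, zero_smul]

theorem exists_isFlatThrough [FiniteDimensional ℂ F] (hD : IsHolConnection D) (x : X) (v : E x) :
    ∃ s, IsFlatThrough D x v s := by
  obtain ⟨s, hs, hsx, hflat⟩ := exists_nabla_eq_zero hD x v
  refine ⟨s, hs, ?_, hsx⟩
  filter_upwards [eventually_mem_chart_source x, hflat] with y hy hsy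
  exact connection_eq_zero hy hsy

end Nabla

section HomBundles

variable {X : Type*} [TopologicalSpace X] [ChartedSpace ℂ X]
  {F₁ : Type*} [NormedAddCommGroup F₁] [NormedSpace ℂ F₁] [FiniteDimensional ℂ F₁]
  {E₁ : X → Type*} [TopologicalSpace (TotalSpace F₁ E₁)]
  [∀ x, AddCommGroup (E₁ x)] [∀ x, Module ℂ (E₁ x)] [∀ x, TopologicalSpace (E₁ x)]
  [FiberBundle F₁ E₁] [VectorBundle ℂ F₁ E₁] [ContMDiffVectorBundle ω F₁ E₁ 𝓘(ℂ, ℂ)]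
  {F₂ : Type*} [NormedAddCommGroup F₂] [NormedSpace ℂ F₂]
  {E₂ : X → Type*} [TopologicalSpace (TotalSpace F₂ E₂)]
  [∀ x, AddCommGroup (E₂ x)] [∀ x, Module ℂ (E₂ x)] [∀ x, TopologicalSpace (E₂ x)]
  [∀ x, IsTopologicalAddGroup (E₂ x)] [∀ x, ContinuousSMul ℂ (E₂ x)]
  [FiberBundle F₂ E₂] [VectorBundle ℂ F₂ E₂] [ContMDiffVectorBundle ω F₂ E₂ 𝓘(ℂ, ℂ)]

theorem mem_holGerms_hom {Φ : Π y, E₁ y →L[ℂ] E₂ y} {x : X}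
    (h : ∀ s ∈ holGerms F₁ x, (fun y => Φ y (s y)) ∈ holGerms F₂ x) :
    Φ ∈ holGerms (F₁ →L[ℂ] F₂) (E := fun y => E₁ y →L[ℂ] E₂ y) x := by
  refine (contMDiffAt_hom_bundle _).2 ⟨contMDiffAt_id, ?_⟩
  let b := Module.finBasis ℂ F₁
  let T₁ := trivializationAt F₁ E₁ x
  let T₂ := trivializationAt F₂ E₂ x
  have hx₂ : x ∈ T₂.baseSet := FiberBundle.mem_baseSet_trivializationAt' x
  have hcols : ContMDiffAt 𝓘(ℂ, ℂ) 𝓘(ℂ, F₁ →L[ℂ] F₂) ω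
      (fun y => ∑ i, (LinearMap.toContinuousLinearMap (b.coord i)).smulRight
        (T₂ ⟨y, Φ y (T₁.symmL ℂ y (b i))⟩).2) x :=
    contMDiffAt_finsetSum fun i _ =>
      ((ContinuousLinearMap.smulRightL ℂ F₁ F₂
        (LinearMap.toContinuousLinearMap (b.coord i))).contMDiff _).comp x
        ((T₂.contMDiffAt_section_iff hx₂).1 (h _ (symmL_mem_holGerms x (b i))))
  refine hcols.congr_of_eventuallyEq ?_
  filter_upwards [T₂.open_baseSet.mem_nhds hx₂] with y hy
  refine ContinuousLinearMap.coe_inj.1 (b.ext fun j => ?_)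
  simp [ContinuousLinearMap.inCoordinates, T₁, T₂, Trivialization.coe_linearMapAt_of_mem T₂ hy,
    Finsupp.single_apply]

end HomBundles

section TangentFields

variable {X : Type*} [TopologicalSpace X] [ChartedSpace ℂ X] [IsManifold 𝓘(ℂ, ℂ) ω X] {x : X}

theorem dz_ne_zero : dz x x ≠ 0 := by
  intro h
  obtain ⟨c, hc⟩ := exists_eq_smul_dz (mem_chart_source ℂ x) (1 : ℂ)
  rw [h, smul_zero] at hc
  exact one_ne_zero (α := ℂ) hc

theorem holAt_mvfderiv {g : X → ℂ} {w : Π y, TangentSpace 𝓘(ℂ, ℂ) y} (hg : HolAt g x)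
    (hw : w ∈ holGerms ℂ x) : HolAt (fun y => mvfderiv 𝓘(ℂ, ℂ) g y (w y)) x := by
  have hspan : ∀ᶠ y in 𝓝 x, ∃ c : Unit → ℂ, w y = ∑ i, c i • dz x y := by
    filter_upwards [eventually_mem_chart_source x] with y hy
    obtain ⟨c, hc⟩ := exists_eq_smul_dz hy (w y)
    exact ⟨fun _ => c, by simpa using hc⟩
  obtain ⟨u, hu⟩ := hspan.choice
  have hu_hol : HolAt (fun y => u y ()) x :=
    holAt_coeff (e := fun _ => dz x) (fun _ => symmL_mem_holGerms x (1 : ℂ))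
      (LinearIndependent.of_subsingleton () dz_ne_zero) hw hu ()
  have hg' := ((holAt_iff_analyticAt (mem_chart_source ℂ x)).1 hg).deriv
  refine (hu_hol.mul (holAt_comp_chart (mem_chart_source ℂ x) hg')).congr ?_
  have hg_nhds : ∀ᶠ y in 𝓝 x, HolAt g y := (contMDiffAt_iff_contMDiffAt_nhds (by simp)).1 hg
  filter_upwards [hu, eventually_mem_chart_source x, hg_nhds] with y hy hyx hgy
  rw [← mvfderiv_dz hyx hgy.mdifferentiableAt, hy]
  simp

end TangentFields

section DualConnection

variable {X : Type*} [TopologicalSpace X] [ChartedSpace ℂ X] [IsManifold 𝓘(ℂ, ℂ) ω X]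
  {F : Type*} [NormedAddCommGroup F] [NormedSpace ℂ F] [FiniteDimensional ℂ F]
  {E : X → Type*} [TopologicalSpace (TotalSpace F E)]
  [∀ x, AddCommGroup (E x)] [∀ x, Module ℂ (E x)] [∀ x, TopologicalSpace (E x)]
  [∀ x, IsTopologicalAddGroup (E x)] [∀ x, ContinuousSMul ℂ (E x)]
  [FiberBundle F E] [VectorBundle ℂ F E] [ContMDiffVectorBundle ω F E 𝓘(ℂ, ℂ)]
  {D : CovariantDerivative 𝓘(ℂ, ℂ) F E} {φ : Π y, Dual E y} {s : Π y, E y} {x : X}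

theorem dualConnection_apply {y : X} (hφ : φ ∈ holGerms (F →L[ℂ] ℂ) y) (hs : s ∈ holGerms F y)
    (v : TangentSpace 𝓘(ℂ, ℂ) y) :
    (dualConnection D φ y v (s y) : ℂ) =
      mvfderiv 𝓘(ℂ, ℂ) (fun z => (φ z (s z) : ℂ)) y v - φ y (D s y v) :=
  dualDerivative_apply D (mdifferentiableAt_of_mem_holGerms hφ)
    (mdifferentiableAt_of_mem_holGerms hs) v

theorem IsHolConnection.dualConnection (hD : IsHolConnection D) :
    IsHolConnection (dualConnection D) := by
  intro x φ hφ
  refine mem_holGerms_hom fun w hw => mem_holGerms_hom fun s hs => ?_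
  have hDs : (fun y => D s y (w y)) ∈ holGerms F x := ContMDiffAt.clm_bundle_apply (hD x s hs) hw
  refine (contMDiffAt_section (E := Trivial X ℂ) x).2 <|
    ((holAt_mvfderiv (holAt_pairing hφ hs) hw).sub (holAt_pairing hφ hDs)).congr_of_eventuallyEq ?_
  filter_upwards [eventually_mem_holGerms hφ, eventually_mem_holGerms hs] with y hφy hsy
  exact dualConnection_apply hφy hsy (w y)

theorem nabla_dualConnection_apply {y : X} (hφ : φ ∈ holGerms (F →L[ℂ] ℂ) y)
    (hs : s ∈ holGerms F y) :
    (nabla (dualConnection D) x φ y (s y) : ℂ) =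
      mvfderiv 𝓘(ℂ, ℂ) (fun z => (φ z (s z) : ℂ)) y (dz x y) - φ y (nabla D x s y) :=
  dualConnection_apply hφ hs (dz x y)

/-- The derivative of a locally constant pairing vanishes, so `∇` moves across it with a sign. -/
theorem eventually_nabla_dualConnection_apply {c : ℂ} (hφ : φ ∈ holGerms (F →L[ℂ] ℂ) x)
    (hs : s ∈ holGerms F x) (h : ∀ᶠ y in 𝓝 x, (φ y (s y) : ℂ) = c) :
    ∀ᶠ y in 𝓝 x, (nabla (dualConnection D) x φ y (s y) : ℂ) = -φ y (nabla D x s y) := by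
  filter_upwards [h.eventually_nhds, eventually_mem_holGerms hφ, eventually_mem_holGerms hs]
    with y hy hφy hsy
  have hconst : (fun z => (φ z (s z) : ℂ)) =ᶠ[𝓝 y] fun _ => c := hy
  rw [nabla_dualConnection_apply hφy hsy, mvfderiv_congr hconst, mvfderiv_const]
  exact zero_sub _

end DualConnection

section DerivedFrames

variable {X : Type*} [TopologicalSpace X] [ChartedSpace ℂ X] [IsManifold 𝓘(ℂ, ℂ) ω X]
  {F : Type*} [NormedAddCommGroup F] [NormedSpace ℂ F]
  {E : X → Type*} [TopologicalSpace (TotalSpace F E)]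
  [∀ x, AddCommGroup (E x)] [∀ x, Module ℂ (E x)] [∀ x, TopologicalSpace (E x)]
  [∀ x, IsTopologicalAddGroup (E x)] [∀ x, ContinuousSMul ℂ (E x)]
  [FiberBundle F E] {D : CovariantDerivative 𝓘(ℂ, ℂ) F E}

/-- The derivatives `∇ʲ s i`, for `j ≤ k`, of a family `s` of sections in the direction of the
preferred chart at `x`. -/
def derivedFrame (D : CovariantDerivative 𝓘(ℂ, ℂ) F E) {ι : Type*} (x : X) (s : ι → Π y, E y)
    (k : ℕ) (p : Fin (k + 1) × ι) : Π y, E y :=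
  (nabla D x)^[p.1] (s p.2)

theorem span_derivedFrame_succ {ι : Type*} (x y : X) (s : ι → Π y, E y) (k : ℕ) :
    Submodule.span ℂ (Set.range fun p => derivedFrame D x s (k + 1) p y) =
      Submodule.span ℂ (Set.range fun p => derivedFrame D x s k p y) ⊔
        Submodule.span ℂ (Set.range fun p => nabla D x (derivedFrame D x s k p) y) := by
  rw [← Submodule.span_union]
  refine le_antisymm (Submodule.span_mono ?_) (Submodule.span_mono (Set.union_subset ?_ ?_))
  · rintro _ ⟨⟨j, i⟩, rfl⟩
    rcases Fin.eq_castSucc_or_eq_last j with ⟨j, rfl⟩ | rfl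
    · exact .inl ⟨(j, i), rfl⟩
    · exact .inr ⟨(Fin.last k, i), (iterate_nabla_succ x (s i) k y).symm⟩
  · rintro _ ⟨⟨j, i⟩, rfl⟩
    exact ⟨(j.castSucc, i), rfl⟩
  · rintro _ ⟨⟨j, i⟩, rfl⟩
    exact ⟨(j.succ, i), iterate_nabla_succ x (s i) j y⟩

variable [VectorBundle ℂ F E] {ι : Type*} {x : X} {V : ∀ y, Submodule ℂ (E y)} {s : ι → Π y, E y}

variable (F D x V s) in
/-- `s` is a frame of `V` near `x` whose derivatives up to order `N` are independent, so that they
frame the iterates `(Dhat D)^[k] V` for `k ≤ N`. -/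
structure IsDerivedFrameAt (N : ℕ) : Prop extends IsFrameAt F x V s where
  derived_linearIndependent : LinearIndependent ℂ fun p => derivedFrame D x s N p x

theorem IsDerivedFrameAt.linearIndependent_of_le {N k : ℕ} (hs : IsDerivedFrameAt F D x V s N)
    (hk : k ≤ N) : LinearIndependent ℂ fun p => derivedFrame D x s k p x :=
  hs.derived_linearIndependent.comp (Prod.map (Fin.castLE (by omega)) id)
    ((Fin.castLE_injective _).prodMap Function.injective_id)

variable [FiniteDimensional ℂ F] [ContMDiffVectorBundle ω F E 𝓘(ℂ, ℂ)] [Finite ι]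

theorem IsFrameAt.eventually_derived_eq (hs : IsFrameAt F x V s) :
    ∀ᶠ y in 𝓝 x, derived D V y =
      V y ⊔ Submodule.span ℂ (Set.range fun i => nabla D x (s i) y) := by
  cases nonempty_fintype ι
  filter_upwards [hs.eventually_isFrameAt, eventually_mem_chart_source x] with y hsy hy
  refine le_antisymm (sup_le le_sup_left (Submodule.span_le.2 ?_))
    (sup_le_sup_left (Submodule.span_mono ?_) _)
  · rintro _ ⟨t, ht, htV, v, rfl⟩
    obtain ⟨c, rfl⟩ := exists_eq_smul_dz hy v
    obtain ⟨u, hu, hut⟩ := hsy.exists_coeff ht htV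
    rw [connection_congr (sum_smul_mem_holGerms (fun i _ => hu i) fun i _ => hsy.mem i) hut,
      connection_sum_smul (fun i _ => hu i) fun i _ => hsy.mem i]
    refine Submodule.sum_mem _ fun i _ => Submodule.add_mem _ (Submodule.smul_mem _ _ ?_) ?_
    · rw [map_smul]
      exact Submodule.smul_mem _ _ (Submodule.mem_sup_right (Submodule.subset_span ⟨i, rfl⟩))
    · exact Submodule.smul_mem _ _
        (Submodule.mem_sup_left (hsy.eventually_mem_subspace.self_of_nhds i))
  · rintro _ ⟨i, rfl⟩
    exact ⟨s i, hsy.mem i, hsy.eventually_mem_subspace.mono fun z hz => hz i, dz x y, rfl⟩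

theorem IsDerivedFrameAt.isFrameAt_derived (hD : IsHolConnection D) {N k : ℕ}
    (hs : IsDerivedFrameAt F D x V s N) (hk : k < N) {A : ∀ y, Submodule ℂ (E y)}
    (hA : IsFrameAt F x A (derivedFrame D x s k)) :
    IsFrameAt F x (derived D A) (derivedFrame D x s (k + 1)) where
  mem p := iterate_nabla_mem_holGerms hD (hs.mem p.2) p.1
  linearIndependent := hs.linearIndependent_of_le hk
  span_eq := by
    filter_upwards [hA.span_eq, hA.eventually_derived_eq (D := D)] with y hAy hy
    rw [hy, span_derivedFrame_succ, hAy]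

theorem isFrameAt_iterate_Dhat (hD : IsHolConnection D) {N : ℕ}
    (h : ∀ x, ∃ (ι : Type) (_ : Finite ι) (s : ι → Π y, E y), IsDerivedFrameAt F D x V s N)
    {ι : Type} [Finite ι] {s : ι → Π y, E y} (hs : IsDerivedFrameAt F D x V s N) {k : ℕ}
    (hk : k ≤ N) : IsFrameAt F x ((Dhat D)^[k] V) (derivedFrame D x s k) := by
  induction k generalizing x ι with
  | zero =>
    have hrange : ∀ y, Set.range (fun p => derivedFrame D x s 0 p y) =
        Set.range fun i => s i y := fun y =>
      Set.ext fun v => ⟨fun ⟨p, hp⟩ => ⟨p.2, by simpa [derivedFrame] using hp⟩,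
        fun ⟨i, hi⟩ => ⟨(0, i), hi⟩⟩
    exact
      { mem := fun p => iterate_nabla_mem_holGerms hD (hs.mem p.2) p.1
        linearIndependent := hs.linearIndependent_of_le hk
        span_eq := by simpa only [hrange, Function.iterate_zero, id_eq] using hs.span_eq }
  | succ k ih =>
    have hsub : IsHolSubbundle F (derived D ((Dhat D)^[k] V)) :=
      isHolSubbundle_of_isFrameAt fun y => by
        obtain ⟨κ, _, t, ht⟩ := h y
        exact ⟨_, inferInstance, _, ht.isFrameAt_derived hD hk (ih ht (by omega))⟩
    rw [Function.iterate_succ_apply', Dhat_eq_derived hsub]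
    exact hs.isFrameAt_derived hD hk (ih hs (by omega))

end DerivedFrames

section Jets

theorem card_le_analyticOrderAt_prod {ι : Type*} {h : ι → ℂ → ℂ} {a : ℂ}
    (hh : ∀ i, AnalyticAt ℂ (h i) a) (h0 : ∀ i, h i a = 0) (t : Finset ι) :
    (t.card : ℕ∞) ≤ analyticOrderAt (fun w => ∏ i ∈ t, h i w) a := by
  classical
  induction t using Finset.induction_on with
  | empty => simp
  | insert i t hi ih =>
    simp only [Finset.card_insert_of_notMem hi, Finset.prod_insert hi]
    have hone : 1 ≤ analyticOrderAt (h i) a :=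
      Order.one_le_iff_ne_zero.2 (analyticOrderAt_ne_zero.2 ⟨hh i, h0 i⟩)
    have hmul := analyticOrderAt_mul (hh i) (Finset.analyticAt_fun_prod t fun i _ => hh i)
    rw [add_comm, Nat.cast_add, Nat.cast_one]
    exact (add_le_add hone ih).trans_eq hmul.symm

variable {X : Type*} [TopologicalSpace X] [ChartedSpace ℂ X]
  {V : X → Type*} [∀ x, AddCommGroup (V x)] [∀ x, Module ℂ (V x)] {Γ : HolGerms V}

theorem mem_vanishing_of_eventually_eq_zero {k : ℕ} {y : X} {ρ : Γ y}
    (hρ : ∀ᶠ z in 𝓝 y, ρ.1 z = 0) : ρ ∈ vanishing Γ k y := by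
  classical
  let χ : X → ℂ := fun z => if ρ.1 z = 0 then 0 else 1
  have hχ : HolAt χ y := (holAt_const 0 y).congr (hρ.mono fun z hz => by simp [χ, hz])
  refine Submodule.subset_span ⟨fun _ => χ, ρ, fun _ => ⟨hχ, by simp [χ, hρ.self_of_nhds]⟩, ?_⟩
  ext z
  by_cases hz : ρ.1 z = 0 <;> simp [χ, hz]

variable {ι : Type*} [Fintype ι] {φ : ι → ∀ z, V z →ₗ[ℂ] ℂ} {q : ι → Π z, V z} {x y : X}

/-- A finite family of holomorphic functionals `φ` and sections `q` which are dual to each other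
near `y`, for a family of vector spaces whose holomorphic sections form a module over the
holomorphic functions. -/
structure IsCoframeAt (Γ : HolGerms V) (φ : ι → ∀ z, V z →ₗ[ℂ] ℂ) (q : ι → Π z, V z) (y : X) :
    Prop where
  smul_mem : ∀ σ ∈ Γ y, ∀ g, HolAt g y → (fun z => g z • σ z) ∈ Γ y
  holAt : ∀ σ ∈ Γ y, ∀ i, HolAt (fun z => φ i z (σ z)) y
  mem : ∀ i, q i ∈ Γ y
  eq_sum : ∀ᶠ z in 𝓝 y, ∀ v : V z, v = ∑ i, φ i z v • q i z

variable [IsManifold 𝓘(ℂ, ℂ) ω X]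

/-- The derivative of order `j` of the coordinate `φ σ` of a section `σ`, in the chart at `x`. -/
def taylorCoeff (x : X) (φ : ∀ z, V z →ₗ[ℂ] ℂ) (j : ℕ) (y : X) (σ : Π z, V z) : ℂ :=
  iteratedDeriv j ((fun z => φ z (σ z)) ∘ (chartAt ℂ x).symm) (chartAt ℂ x y)

theorem analyticAt_coord (hy : y ∈ (chartAt ℂ x).source) (hφ : IsCoframeAt Γ φ q y)
    {σ : Π z, V z} (hσ : σ ∈ Γ y) (i : ι) :
    AnalyticAt ℂ ((fun z => φ i z (σ z)) ∘ (chartAt ℂ x).symm) (chartAt ℂ x y) :=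
  (holAt_iff_analyticAt hy).1 (hφ.holAt _ hσ i)

/-- `taylorCoeff` as a linear functional on the holomorphic sections. -/
def taylorForm (hy : y ∈ (chartAt ℂ x).source) (hφ : IsCoframeAt Γ φ q y) (j : ℕ) (i : ι) :
    Γ y →ₗ[ℂ] ℂ where
  toFun σ := taylorCoeff x (φ i) j y σ.1
  map_add' σ τ := by
    rw [taylorCoeff, taylorCoeff, taylorCoeff,
      ← iteratedDeriv_add (analyticAt_coord hy hφ σ.2 i).contDiffAt
        (analyticAt_coord hy hφ τ.2 i).contDiffAt]
    congr 1
    ext w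
    simp
  map_smul' c σ := by
    rw [RingHom.id_apply, taylorCoeff, taylorCoeff, ← iteratedDeriv_const_smul_field]
    congr 1
    ext w
    simp

theorem vanishing_le_ker_taylorForm (hy : y ∈ (chartAt ℂ x).source) (hφ : IsCoframeAt Γ φ q y)
    {k : ℕ} (j : Fin (k + 1)) (i : ι) :
    vanishing Γ k y ≤ LinearMap.ker (taylorForm hy hφ j i) := by
  refine Submodule.span_le.2 ?_
  rintro σ ⟨h, τ, hh, hστ⟩
  have hhan : ∀ l, AnalyticAt ℂ (h l ∘ (chartAt ℂ x).symm) (chartAt ℂ x y) := fun l =>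
    (holAt_iff_analyticAt hy).1 (hh l).1
  have hh0 : ∀ l, (h l ∘ (chartAt ℂ x).symm) (chartAt ℂ x y) = 0 := fun l => by
    rw [Function.comp_apply, (chartAt ℂ x).left_inv hy, (hh l).2]
  have hmul : (fun z => φ i z (σ.1 z)) ∘ (chartAt ℂ x).symm =
      (fun w => ∏ l, (h l ∘ (chartAt ℂ x).symm) w) *
        ((fun z => φ i z (τ.1 z)) ∘ (chartAt ℂ x).symm) := by
    ext w
    simp [hστ]
  have hord : ((k + 1 : ℕ) : ℕ∞) ≤
      analyticOrderAt ((fun z => φ i z (σ.1 z)) ∘ (chartAt ℂ x).symm) (chartAt ℂ x y) := by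
    rw [hmul, analyticOrderAt_mul (Finset.analyticAt_fun_prod _ fun l _ => hhan l)
      (analyticAt_coord hy hφ τ.2 i)]
    simpa using (card_le_analyticOrderAt_prod hhan hh0 Finset.univ).trans le_self_add
  exact (natCast_le_analyticOrderAt_iff_iteratedDeriv_eq_zero
    (analyticAt_coord hy hφ σ.2 i)).1 hord j j.2

theorem mem_vanishing_of_taylorCoeff_eq_zero (hy : y ∈ (chartAt ℂ x).source)
    (hφ : IsCoframeAt Γ φ q y) {k : ℕ} {σ : Γ y}
    (h : ∀ j < k + 1, ∀ i, taylorCoeff x (φ i) j y σ.1 = 0) : σ ∈ vanishing Γ k y := by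
  have hord : ∀ i, ∃ g, AnalyticAt ℂ g (chartAt ℂ x y) ∧ ∀ᶠ w in 𝓝 (chartAt ℂ x y),
      ((fun z => φ i z (σ.1 z)) ∘ (chartAt ℂ x).symm) w =
        (w - chartAt ℂ x y) ^ (k + 1) • g w := fun i =>
    (natCast_le_analyticOrderAt (analyticAt_coord hy hφ σ.2 i)).1
      ((natCast_le_analyticOrderAt_iff_iteratedDeriv_eq_zero (analyticAt_coord hy hφ σ.2 i)).2
        fun j hj => h j hj i)
  choose g hg hgσ using hord
  let ζ : X → ℂ := fun z => chartAt ℂ x z - chartAt ℂ x y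
  have hζ : HolAt ζ y := holAt_comp_chart (h := fun w => w - chartAt ℂ x y) hy (by fun_prop)
  let τ : ι → Γ y := fun i => ⟨fun z => g i (chartAt ℂ x z) • q i z,
    hφ.smul_mem _ (hφ.mem i) _ (holAt_comp_chart hy (hg i))⟩
  let ρ : ι → Γ y := fun i => ⟨fun z => (∏ _ : Fin (k + 1), ζ z) • (τ i).1 z,
    hφ.smul_mem _ (τ i).2 _ (HolAt.prod fun _ _ => hζ)⟩
  have hρ : ∀ i, ρ i ∈ vanishing Γ k y := fun i =>
    Submodule.subset_span ⟨fun _ => ζ, τ i, fun _ => ⟨hζ, sub_self _⟩, rfl⟩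
  have hσρ : ∀ᶠ z in 𝓝 y, (σ - ∑ i, ρ i).1 z = 0 := by
    filter_upwards [hφ.eq_sum, (chartAt ℂ x).open_source.mem_nhds hy,
      ((chartAt ℂ x).continuousAt hy).eventually (eventually_all.2 hgσ)] with z hsum hz hgz
    have hcoord : ∀ i, φ i z (σ.1 z) = ζ z ^ (k + 1) * g i (chartAt ℂ x z) := fun i => by
      simpa only [Function.comp_apply, smul_eq_mul, ζ] using
        (congrArg (fun z => φ i z (σ.1 z)) ((chartAt ℂ x).left_inv hz)).symm.trans (hgz i)
    have hz' : (σ - ∑ i, ρ i).1 z = σ.1 z - ∑ i, (ρ i).1 z := by simp [Finset.sum_apply]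
    rw [hz', sub_eq_zero]
    refine (hsum _).trans (Finset.sum_congr rfl fun i _ => ?_)
    simp [ρ, τ, hcoord, mul_smul]
  exact (sub_add_cancel σ (∑ i, ρ i)) ▸ Submodule.add_mem _
    (mem_vanishing_of_eventually_eq_zero hσρ) (Submodule.sum_mem _ fun i _ => hρ i)

open Classical in
/-- The functional on the fibre at `y` of the jet bundle which sends the jet of `σ` to
`taylorCoeff x φ j y σ` (and `0` if the latter is not determined by the jet). -/
def jetForm (Γ : HolGerms V) (k : ℕ) (x : X) (φ : ∀ z, V z →ₗ[ℂ] ℂ) (j : ℕ) (y : X) :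
    JetFiber Γ k y →ₗ[ℂ] ℂ :=
  if h : ∃ C : JetFiber Γ k y →ₗ[ℂ] ℂ, ∀ σ ∈ Γ y, C (jetAt Γ k y σ) = taylorCoeff x φ j y σ then
    h.choose else 0

theorem jetForm_jetAt (hy : y ∈ (chartAt ℂ x).source) (hφ : IsCoframeAt Γ φ q y) {k : ℕ}
    (j : Fin (k + 1)) (i : ι) {σ : Π z, V z} (hσ : σ ∈ Γ y) :
    jetForm Γ k x (φ i) j y (jetAt Γ k y σ) = taylorCoeff x (φ i) j y σ := by
  have h : ∃ C : JetFiber Γ k y →ₗ[ℂ] ℂ, ∀ σ ∈ Γ y,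
      C (jetAt Γ k y σ) = taylorCoeff x (φ i) j y σ :=
    ⟨(vanishing Γ k y).liftQ _ (vanishing_le_ker_taylorForm hy hφ j i), fun σ hσ => by
      rw [jetAt, dif_pos hσ]
      rfl⟩
  rw [jetForm, dif_pos h]
  exact h.choose_spec σ hσ

theorem eq_zero_of_jetForm_eq_zero (hy : y ∈ (chartAt ℂ x).source) (hφ : IsCoframeAt Γ φ q y)
    {k : ℕ} {J : JetFiber Γ k y} (hJ : ∀ p : Fin (k + 1) × ι, jetForm Γ k x (φ p.2) p.1 y J = 0) :
    J = 0 := by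
  obtain ⟨σ, rfl⟩ := Submodule.mkQ_surjective _ J
  refine (Submodule.Quotient.mk_eq_zero _).2 (mem_vanishing_of_taylorCoeff_eq_zero hy hφ ?_)
  intro j hj i
  rw [← jetForm_jetAt hy hφ ⟨j, hj⟩ i σ.2, jetAt, dif_pos σ.2]
  exact hJ (⟨j, hj⟩, i)

theorem holAt_jetForm (hΓ : ∀ σ ∈ Γ x, ∀ᶠ y in 𝓝 x, σ ∈ Γ y)
    (hφ : ∀ᶠ y in 𝓝 x, IsCoframeAt Γ φ q y) {k : ℕ} (j : Fin (k + 1)) (i : ι)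
    {ρ : Π y, JetFiber Γ k y} (hρ : ρ ∈ jetGerms Γ k x) :
    HolAt (fun y => jetForm Γ k x (φ i) j y (ρ y)) x := by
  induction hρ using Submodule.span_induction with
  | mem ρ hρ =>
    obtain ⟨g, σ, hg, hσ, hρ⟩ := hρ
    have htaylor : HolAt (fun y => taylorCoeff x (φ i) j y σ) x := by
      refine holAt_comp_chart (mem_chart_source ℂ x) ?_
      rw [iteratedDeriv_eq_iterate]
      exact (analyticAt_coord (mem_chart_source ℂ x) hφ.self_of_nhds hσ i).iterated_deriv j
    refine (hg.mul htaylor).congr ?_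
    filter_upwards [hρ, hφ, hΓ σ hσ, eventually_mem_chart_source x] with y hρy hφy hσy hy
    rw [hρy, map_smul, jetForm_jetAt hy hφy j i hσy, smul_eq_mul]
  | zero => exact (holAt_const 0 x).congr (.of_forall fun y => map_zero _)
  | add ρ ρ' _ _ ih ih' =>
    exact HolAt.congr (ContMDiffAt.add ih ih') (.of_forall fun y => map_add _ _ _)
  | smul c ρ _ ih =>
    exact ((holAt_const c x).mul ih).congr (.of_forall fun y => map_smul (jetForm Γ k x _ j y) c _)

end Jets

section QuotientForms

variable {X : Type*} {E : X → Type*} [∀ x, AddCommGroup (E x)] [∀ x, Module ℂ (E x)]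
  [∀ x, TopologicalSpace (E x)] {V : ∀ x, Submodule ℂ (E x)}

open Classical in
/-- The functional induced on `E / V` by a functional on `E` (and `0` where the latter does not
vanish on `V`). -/
def quotForm (V : ∀ x, Submodule ℂ (E x)) (ℓ : Π y, Dual E y) (y : X) : (E y ⧸ V y) →ₗ[ℂ] ℂ :=
  if h : V y ≤ LinearMap.ker (ℓ y).toLinearMap then (V y).liftQ (ℓ y).toLinearMap h else 0

theorem quotForm_mkQ {ℓ : Π y, Dual E y} {y : X} (h : ∀ v ∈ V y, ℓ y v = 0) (v : E y) :
    quotForm V ℓ y ((V y).mkQ v) = ℓ y v := by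
  rw [quotForm, dif_pos (show V y ≤ LinearMap.ker (ℓ y).toLinearMap from h)]
  rfl

end QuotientForms

section QuotientCoframes

variable {X : Type*} [TopologicalSpace X] [ChartedSpace ℂ X]
  {F : Type*} [NormedAddCommGroup F] [NormedSpace ℂ F]
  {E : X → Type*} [TopologicalSpace (TotalSpace F E)]
  [∀ x, AddCommGroup (E x)] [∀ x, Module ℂ (E x)] [∀ x, TopologicalSpace (E x)]
  [FiberBundle F E] [VectorBundle ℂ F E]
  {V : ∀ x, Submodule ℂ (E x)} {x : X}

theorem mkQ_mem_quotGerms {s : Π y, E y} (hs : s ∈ holGerms F x) :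
    (fun y => (V y).mkQ (s y)) ∈ quotGerms F V x :=
  ⟨s, hs, .of_forall fun _ => rfl⟩

theorem eventually_mem_quotGerms [IsManifold 𝓘(ℂ, ℂ) ω X]
    [ContMDiffVectorBundle ω F E 𝓘(ℂ, ℂ)] {σ : Π y, E y ⧸ V y} (hσ : σ ∈ quotGerms F V x) :
    ∀ᶠ y in 𝓝 x, σ ∈ quotGerms F V y := by
  obtain ⟨s, hs, h⟩ := hσ
  filter_upwards [eventually_mem_holGerms hs, h.eventually_nhds] with y hy hy'
  exact ⟨s, hy, hy'⟩

/-- Near `x`, the functionals `φ` annihilate `V` and the sections `t` project to the frame of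
`E / V` dual to `φ`. -/
structure IsQuotCoframeAt (F : Type*) [NormedAddCommGroup F] [NormedSpace ℂ F]
    {E : X → Type*} [TopologicalSpace (TotalSpace F E)]
    [∀ x, AddCommGroup (E x)] [∀ x, Module ℂ (E x)] [∀ x, TopologicalSpace (E x)]
    [∀ x, IsTopologicalAddGroup (E x)] [∀ x, ContinuousSMul ℂ (E x)]
    [FiberBundle F E] [VectorBundle ℂ F E] (x : X) (V : ∀ x, Submodule ℂ (E x))
    {ι : Type*} [Fintype ι] (φ : ι → Π y, Dual E y) (t : ι → Π y, E y) : Prop where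
  form_mem : ∀ i, φ i ∈ holGerms (F →L[ℂ] ℂ) x
  mem : ∀ i, t i ∈ holGerms F x
  form_eq_zero : ∀ᶠ y in 𝓝 x, ∀ i, ∀ v ∈ V y, φ i y v = 0
  sub_mem : ∀ᶠ y in 𝓝 x, ∀ v : E y, v - ∑ i, (φ i y v : ℂ) • t i y ∈ V y

variable [∀ x, IsTopologicalAddGroup (E x)] [∀ x, ContinuousSMul ℂ (E x)]
  {ι : Type*} [Fintype ι] {φ : ι → Π y, Dual E y} {t : ι → Π y, E y}

theorem IsQuotCoframeAt.isCoframeAt (h : IsQuotCoframeAt F x V φ t) :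
    IsCoframeAt (quotGerms F V) (fun i => quotForm V (φ i)) (fun i y => (V y).mkQ (t i y)) x where
  smul_mem := by
    rintro σ ⟨s, hs, hσ⟩ g hg
    exact ⟨fun y => g y • s y, smul_mem_holGerms hg hs,
      hσ.mono fun y hy => by simp only [hy, map_smul]⟩
  holAt := by
    rintro σ ⟨s, hs, hσ⟩ i
    refine (holAt_pairing (h.form_mem i) hs).congr ?_
    filter_upwards [hσ, h.form_eq_zero] with y hy hφ
    rw [hy, quotForm_mkQ (hφ i)]
  mem i := mkQ_mem_quotGerms (h.mem i)
  eq_sum := by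
    filter_upwards [h.form_eq_zero, h.sub_mem] with y hφ hsub v
    obtain ⟨w, rfl⟩ := Submodule.mkQ_surjective _ v
    simp only [quotForm_mkQ (hφ _), ← map_smul, ← map_sum]
    exact (Submodule.Quotient.eq _).2 (hsub w)

variable [IsManifold 𝓘(ℂ, ℂ) ω X] [ContMDiffVectorBundle ω F E 𝓘(ℂ, ℂ)]

theorem IsQuotCoframeAt.eventually_isQuotCoframeAt (h : IsQuotCoframeAt F x V φ t) :
    ∀ᶠ y in 𝓝 x, IsQuotCoframeAt F y V φ t := by
  filter_upwards [eventually_all.2 fun i => eventually_mem_holGerms (h.form_mem i),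
    eventually_all.2 fun i => eventually_mem_holGerms (h.mem i), h.form_eq_zero.eventually_nhds,
    h.sub_mem.eventually_nhds] with y h₁ h₂ h₃ h₄
  exact ⟨h₁, h₂, h₃, h₄⟩

end QuotientCoframes

section FlatTaylor

variable {X : Type*} [TopologicalSpace X] [ChartedSpace ℂ X] [IsManifold 𝓘(ℂ, ℂ) ω X]
  {F : Type*} [NormedAddCommGroup F] [NormedSpace ℂ F] [FiniteDimensional ℂ F]
  {E : X → Type*} [TopologicalSpace (TotalSpace F E)]
  [∀ x, AddCommGroup (E x)] [∀ x, Module ℂ (E x)] [∀ x, TopologicalSpace (E x)]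
  [∀ x, IsTopologicalAddGroup (E x)] [∀ x, ContinuousSMul ℂ (E x)]
  [FiberBundle F E] [VectorBundle ℂ F E] [ContMDiffVectorBundle ω F E 𝓘(ℂ, ℂ)]
  {D : CovariantDerivative 𝓘(ℂ, ℂ) F E}

theorem eventually_iteratedDeriv_flat_pairing {x y : X}
    (hy : y ∈ (chartAt ℂ x).source) {φ : Π y, Dual E y} {w : Π y, E y} (hw : w ∈ holGerms F y)
    (hflat : ∀ᶠ z in 𝓝 y, D w z = 0) {k : ℕ}
    (hφ : ∀ j < k, (nabla (dualConnection D) x)^[j] φ ∈ holGerms (F →L[ℂ] ℂ) y) :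
    ∀ᶠ z in 𝓝 y, iteratedDeriv k ((fun z => (φ z (w z) : ℂ)) ∘ (chartAt ℂ x).symm)
      (chartAt ℂ x z) = (nabla (dualConnection D) x)^[k] φ z (w z) := by
  induction k with
  | zero =>
    filter_upwards [(chartAt ℂ x).open_source.mem_nhds hy] with z hz
    rw [iteratedDeriv_zero]
    exact congrArg (fun z => (φ z (w z) : ℂ)) ((chartAt ℂ x).left_inv hz)
  | succ k ih =>
    filter_upwards [(ih fun j hj => hφ j (by omega)).eventually_nhds,
      (chartAt ℂ x).open_source.mem_nhds hy, eventually_mem_holGerms (hφ k (by omega)),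
      eventually_mem_holGerms hw, hflat] with z hz hzs hφz hwz hDw
    have hcoord : iteratedDeriv k ((fun z => (φ z (w z) : ℂ)) ∘ (chartAt ℂ x).symm)
        =ᶠ[𝓝 (chartAt ℂ x z)]
          (fun z => ((nabla (dualConnection D) x)^[k] φ z (w z) : ℂ)) ∘ (chartAt ℂ x).symm := by
      filter_upwards [(tendsto_chartAt_symm hzs).eventually hz,
        (chartAt ℂ x).open_target.mem_nhds ((chartAt ℂ x).map_source hzs)] with a ha hat
      rwa [(chartAt ℂ x).right_inv hat] at ha
    have hnabla : nabla D x w z = 0 := by simp [nabla, hDw]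
    rw [iteratedDeriv_succ, hcoord.deriv_eq,
      ← mvfderiv_dz hzs (holAt_pairing hφz hwz).mdifferentiableAt,
      Function.iterate_succ_apply', nabla_dualConnection_apply hφz hwz, hnabla, map_zero,
      sub_zero]

end FlatTaylor

section LinearAlgebra

theorem det_ne_zero_of_antitriangular {ι : Type*} [Fintype ι] [DecidableEq ι] {N : ℕ}
    {P : Matrix (Fin (N + 1) × ι) (Fin (N + 1) × ι) ℂ} {c : ℕ → ℂ} (hc : ∀ j, c j ≠ 0)
    (hlt : ∀ p q, (p.1 + q.1 : ℕ) < N → P p q = 0)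
    (heq : ∀ p q, (p.1 + q.1 : ℕ) = N → P p q = c p.1 * (1 : Matrix ι ι ℂ) p.2 q.2) :
    P.det ≠ 0 := by
  rw [Ne, ← Matrix.exists_mulVec_eq_zero_iff]
  rintro ⟨u, hu, hPu⟩
  have hrev : ∀ (j : Fin (N + 1)) i, u (j.rev, i) = 0 := by
    intro j
    induction j using WellFoundedLT.induction with
    | ind j ih =>
      intro i
      have hsum : ∑ q, P (j, i) q * u q = P (j, i) (j.rev, i) * u (j.rev, i) := by
        refine Fintype.sum_eq_single _ fun ⟨k, l⟩ hkl => ?_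
        rcases lt_trichotomy k j.rev with hk | rfl | hk
        · rw [hlt _ _ (by simp only [Fin.lt_def, Fin.val_rev] at hk ⊢; omega), zero_mul]
        · have hil : i ≠ l := fun h => hkl (by rw [h])
          rw [heq _ _ (by simp only [Fin.val_rev]; omega), Matrix.one_apply_ne hil, mul_zero,
            zero_mul]
        · rw [← Fin.rev_rev k, ih k.rev (Fin.rev_lt_iff.2 hk), mul_zero]
      have hzero := hsum.symm.trans (congrFun hPu (j, i))
      rw [heq _ _ (by simp only [Fin.val_rev]; omega), Matrix.one_apply_eq, mul_one] at hzero
      exact (mul_eq_zero.1 hzero).resolve_left (hc j)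
  exact hu (funext fun p => by simpa using hrev p.1.rev p.2)

end LinearAlgebra

section Functionals

variable {X : Type*} {E : X → Type*} [∀ x, AddCommGroup (E x)] [∀ x, Module ℂ (E x)]
  [∀ x, TopologicalSpace (E x)] {ι : Type*} {x : X}

theorem sum_smul_apply [Fintype ι] (c : ι → ℂ) (φ : ι → Dual E x) (v : E x) :
    ((∑ i, c i • φ i) v : ℂ) = ∑ i, c i * (φ i v : ℂ) :=
  (_root_.sum_apply _ _ v).trans (Finset.sum_congr rfl fun _ _ => rfl)

theorem apply_sum_smul [Fintype ι] (φ : Dual E x) (c : ι → ℂ) (v : ι → E x) :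
    (φ (∑ i, c i • v i) : ℂ) = ∑ i, c i * (φ (v i) : ℂ) :=
  (map_sum φ _ _).trans (Finset.sum_congr rfl fun i _ => map_smul φ (c i) (v i))

/-- The common zero spaces in the fibres of `E` of a family of subspaces of the fibres of `E^*`;
for a subbundle `G` this is `(E^* / G)^*`. -/
def commonZeros (G : ∀ x, Submodule ℂ (Dual E x)) (x : X) : Submodule ℂ (E x) where
  carrier := {v | ∀ φ ∈ G x, (φ v : ℂ) = 0}
  add_mem' hv hw φ hφ := (map_add φ _ _).trans (by rw [hv φ hφ, hw φ hφ, add_zero])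
  zero_mem' φ _ := map_zero φ
  smul_mem' c v hv φ hφ := (map_smul φ c v).trans (by rw [hv φ hφ, smul_zero])

theorem mem_commonZeros_iff [Finite ι] {G : ∀ x, Submodule ℂ (Dual E x)} {φ : ι → Dual E x}
    (h : Submodule.span ℂ (Set.range φ) = G x) {v : E x} :
    v ∈ commonZeros G x ↔ ∀ i, (φ i v : ℂ) = 0 := by
  cases nonempty_fintype ι
  refine ⟨fun hv i => hv _ (h ▸ Submodule.subset_span ⟨i, rfl⟩), fun hv ψ hψ => ?_⟩
  obtain ⟨c, rfl⟩ := (Submodule.mem_span_range_iff_exists_fun ℂ).1 (h.ge hψ)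
  rw [sum_smul_apply]
  exact Finset.sum_eq_zero fun i _ => by rw [hv i, mul_zero]

theorem exists_form_eq_one [Finite ι] [DecidableEq ι] {φ : ι → Dual E x}
    (hφ : LinearIndependent ℂ φ) :
    ∃ e : ι → E x, ∀ i j, (φ i (e j) : ℂ) = (1 : Matrix ι ι ℂ) i j := by
  cases nonempty_fintype ι
  let Φ : E x →ₗ[ℂ] ι → ℂ := LinearMap.pi fun i => (φ i).toLinearMap
  have hΦ : Function.Surjective Φ := by
    rw [← LinearMap.range_eq_top]
    by_contra hlt
    obtain ⟨g, hg, hle⟩ := Submodule.exists_le_ker_of_lt_top _ (lt_top_iff_ne_top.2 hlt)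
    have hsum : ∑ i, g (Pi.single i 1) • φ i = 0 := ContinuousLinearMap.ext fun v => by
      have hv : g (Φ v) = 0 := hle ⟨v, rfl⟩
      rw [← (Pi.basisFun ℂ ι).sum_repr (Φ v), map_sum] at hv
      refine (sum_smul_apply _ _ v).trans (Eq.trans ?_ hv)
      exact Finset.sum_congr rfl fun i _ => by
        rw [map_smul, smul_eq_mul, mul_comm, Pi.basisFun_apply]
        rfl
    exact hg ((Pi.basisFun ℂ ι).ext fun i => by
      rw [Pi.basisFun_apply, Fintype.linearIndependent_iff.1 hφ _ hsum i, LinearMap.zero_apply])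
  choose e he using fun j => hΦ (Pi.single j 1)
  refine ⟨e, fun i j => ?_⟩
  rw [Matrix.one_apply, ← Pi.single_apply, ← he j]
  rfl

theorem linearIndependent_of_form_eq_one [DecidableEq ι] {e : ι → E x} {φ : ι → Dual E x}
    (h : ∀ i j, (φ i (e j) : ℂ) = (1 : Matrix ι ι ℂ) i j) : LinearIndependent ℂ e :=
  LinearIndependent.of_pairwise_dual_eq_zero_one e (fun i => (φ i).toLinearMap)
    (fun i j hij => (h i j).trans (Matrix.one_apply_ne hij))
    fun i => (h i i).trans (Matrix.one_apply_eq i)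

end Functionals

section DualFrames

variable {X : Type*} [TopologicalSpace X] [ChartedSpace ℂ X]
  {F : Type*} [NormedAddCommGroup F] [NormedSpace ℂ F]
  {E : X → Type*} [TopologicalSpace (TotalSpace F E)]
  [∀ x, AddCommGroup (E x)] [∀ x, Module ℂ (E x)] [∀ x, TopologicalSpace (E x)]
  [FiberBundle F E] [VectorBundle ℂ F E]

theorem exists_holAt_inverse {ι : Type*} [Fintype ι] [DecidableEq ι] {M : X → Matrix ι ι ℂ} {x : X}
    (hM : ∀ i j, HolAt (fun y => M y i j) x) (hdet : (M x).det ≠ 0) :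
    ∃ A : X → Matrix ι ι ℂ, (∀ i j, HolAt (fun y => A y i j) x) ∧ ∀ᶠ y in 𝓝 x, M y * A y = 1 := by
  have hinv : ∀ᶠ y in 𝓝 x, M y * (M y)⁻¹ = 1 :=
    ((holAt_det hM).continuousAt.eventually_ne hdet).mono fun y hy =>
      Matrix.mul_nonsing_inv _ (isUnit_iff_ne_zero.2 hy)
  refine ⟨fun y => (M y)⁻¹, fun i j => ?_, hinv⟩
  refine holAt_of_mulVec_eq (u := fun y k => (M y)⁻¹ k j)
    (c := fun _ k => (1 : Matrix ι ι ℂ) k j) hM (fun _ => holAt_const _ _) hdet ?_ i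
  exact hinv.mono fun y hy => funext fun k => congrFun (congrFun hy k) j

variable (F) in
/-- Near `x`, the families `e` and `φ` are mutually dual holomorphic frames of `E` and `E^*`. -/
structure IsDualFrameAt {κ : Type*} [Fintype κ] [DecidableEq κ] (x : X) (e : κ → Π y, E y)
    (φ : κ → Π y, Dual E y) : Prop where
  mem : ∀ i, e i ∈ holGerms F x
  form_mem : ∀ i, φ i ∈ holGerms (F →L[ℂ] ℂ) x
  form_apply : ∀ᶠ y in 𝓝 x, ∀ i j, (φ i y (e j y) : ℂ) = (1 : Matrix κ κ ℂ) i j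
  eq_sum : ∀ᶠ y in 𝓝 x, ∀ v, v = ∑ i, (φ i y v : ℂ) • e i y

variable {κ : Type*} [Fintype κ] [DecidableEq κ] {x : X} {e : κ → Π y, E y} {φ : κ → Π y, Dual E y}

theorem IsFrameAt.isDualFrameAt (he : IsFrameAt F x (fun _ => ⊤) e)
    (hφ : ∀ i, φ i ∈ holGerms (F →L[ℂ] ℂ) x)
    (h : ∀ᶠ y in 𝓝 x, ∀ i j, (φ i y (e j y) : ℂ) = (1 : Matrix κ κ ℂ) i j) :
    IsDualFrameAt F x e φ where
  mem := he.mem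
  form_mem := hφ
  form_apply := h
  eq_sum := by
    filter_upwards [h, he.span_eq] with y hy hspan v
    obtain ⟨c, rfl⟩ := (Submodule.mem_span_range_iff_exists_fun ℂ).1
      (hspan.ge (Submodule.mem_top (x := v)))
    refine Finset.sum_congr rfl fun i _ => congrArg (· • e i y) ?_
    simp [hy, Matrix.one_apply]

variable [∀ x, IsTopologicalAddGroup (E x)] [∀ x, ContinuousSMul ℂ (E x)] [FiniteDimensional ℂ F]

theorem IsFrameAt.exists_isDualFrameAt (he : IsFrameAt F x (fun _ => ⊤) e) :
    ∃ φ, IsDualFrameAt F x e φ := by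
  obtain ⟨φ, hφ, hφe⟩ := exists_dual_sections (F := F) he.linearIndependent
  obtain ⟨A, hA, hMA⟩ := exists_holAt_inverse
    (M := fun y => Matrix.of fun i j => (φ i y (e j y) : ℂ))
    (fun i j => holAt_pairing (hφ i) (he.mem j))
    (by rw [show Matrix.of (fun i j => (φ i x (e j x) : ℂ)) = 1 from Matrix.ext hφe]; simp)
  refine ⟨fun i y => ∑ k, A y i k • φ k y, he.isDualFrameAt
    (fun i => sum_smul_mem_holGerms (fun k _ => hA i k) fun k _ => hφ k) ?_⟩
  filter_upwards [hMA] with y hy i j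
  rw [← mul_eq_one_comm.1 hy, sum_smul_apply]
  rfl

theorem IsFrameAt.exists_isDualFrameAt_of_dual [ContMDiffVectorBundle ω F E 𝓘(ℂ, ℂ)]
    (hφ : IsFrameAt (F →L[ℂ] ℂ) x (fun _ => ⊤) φ) : ∃ e, IsDualFrameAt F x e φ := by
  obtain ⟨v, hv⟩ := exists_form_eq_one hφ.linearIndependent
  choose t ht htx using fun j => exists_mem_holGerms F (v j)
  obtain ⟨A, hA, hMA⟩ := exists_holAt_inverse
    (M := fun y => Matrix.of fun i j => (φ i y (t j y) : ℂ))
    (fun i j => holAt_pairing (hφ.mem i) (ht j))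
    (by simp only [htx, hv]; exact (Matrix.det_one (R := ℂ)).trans_ne one_ne_zero)
  let e : κ → Π y, E y := fun j y => ∑ k, A y k j • t k y
  have he : ∀ j, e j ∈ holGerms F x := fun j =>
    sum_smul_mem_holGerms (fun k _ => hA k j) fun k _ => ht k
  have hform : ∀ᶠ y in 𝓝 x, ∀ i j, (φ i y (e j y) : ℂ) = (1 : Matrix κ κ ℂ) i j := by
    filter_upwards [hMA] with y hy i j
    rw [← hy, apply_sum_smul]
    exact Finset.sum_congr rfl fun k _ => mul_comm _ _
  have hli := linearIndependent_of_form_eq_one hform.self_of_nhds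
  have hcard : Fintype.card κ = Module.finrank ℂ (E x) := by
    rw [finrank_fiber F x, ← Subspace.dual_finrank_eq (K := ℂ) (V := F),
      (LinearMap.toContinuousLinearMap (𝕜 := ℂ) (E := F) (F' := ℂ)).finrank_eq,
      ← finrank_fiber (F →L[ℂ] ℂ) (E := Dual E) x]
    exact (Module.finrank_eq_card_basis
      (Module.Basis.mk hφ.linearIndependent hφ.span_eq.self_of_nhds.ge)).symm
  have := finiteDimensional_fiber F (E := E) x
  exact ⟨e, (isFrameAt_top he hli (hli.span_eq_top_of_card_eq_finrank' hcard)).isDualFrameAt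
    hφ.mem hform⟩

end DualFrames

section CommonZeros

variable {X : Type*} [TopologicalSpace X] [ChartedSpace ℂ X]
  {F : Type*} [NormedAddCommGroup F] [NormedSpace ℂ F] [FiniteDimensional ℂ F]
  {E : X → Type*} [TopologicalSpace (TotalSpace F E)]
  [∀ x, AddCommGroup (E x)] [∀ x, Module ℂ (E x)] [∀ x, TopologicalSpace (E x)]
  [∀ x, IsTopologicalAddGroup (E x)] [∀ x, ContinuousSMul ℂ (E x)]
  [FiberBundle F E] [VectorBundle ℂ F E]

theorem exists_isFrameAt_top_sumElim {ι : Type*} [Finite ι] {x : X} {e : ι → Π y, E y}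
    (he : ∀ i, e i ∈ holGerms F x) (hli : LinearIndependent ℂ fun i => e i x) :
    ∃ (r : ℕ) (t : Fin r → Π y, E y), IsFrameAt F x (fun _ => ⊤) (Sum.elim e t) := by
  have := finiteDimensional_fiber F (E := E) x
  obtain ⟨W, hW⟩ := (Submodule.span ℂ (Set.range fun i => e i x)).exists_isCompl
  let b := Module.finBasis ℂ W
  have hb : Submodule.span ℂ (Set.range fun a => (b a : E x)) = W := by
    rw [show (fun a => (b a : E x)) = W.subtype ∘ b from rfl, Set.range_comp, Submodule.span_image,
      b.span_eq, Submodule.map_top, Submodule.range_subtype]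
  choose t ht htx using fun a => exists_mem_holGerms F (b a : E x)
  have helim : (fun i => Sum.elim e t i x) = Sum.elim (fun i => e i x) fun a => (b a : E x) := by
    ext (i | a)
    · rfl
    · exact htx a
  refine ⟨_, t, isFrameAt_top (Sum.rec he ht) ?_ ?_⟩
  · rw [helim]
    exact hli.sum_type (b.linearIndependent.map' W.subtype W.ker_subtype)
      (by rw [hb]; exact hW.disjoint)
  · rw [helim, Set.Sum.elim_range, Submodule.span_union, hb, hW.sup_eq_top]

theorem isHolSubbundle_commonZeros [ContMDiffVectorBundle ω F E 𝓘(ℂ, ℂ)]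
    {G : ∀ x, Submodule ℂ (Dual E x)}
    (h : ∀ x, ∃ (ι : Type) (_ : Finite ι) (φ : ι → Π y, Dual E y),
      IsFrameAt (F →L[ℂ] ℂ) x G φ) : IsHolSubbundle F (commonZeros G) := by
  classical
  refine isHolSubbundle_of_isFrameAt fun x => ?_
  obtain ⟨ι, _, φ, hφ⟩ := h x
  cases nonempty_fintype ι
  obtain ⟨r, ψ, hψ⟩ := exists_isFrameAt_top_sumElim hφ.mem hφ.linearIndependent
  obtain ⟨e, he⟩ := hψ.exists_isDualFrameAt_of_dual
  refine ⟨Fin r, inferInstance, fun a => e (.inr a), fun a => he.mem _,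
    (linearIndependent_of_form_eq_one he.form_apply.self_of_nhds).comp _ Sum.inr_injective, ?_⟩
  filter_upwards [hφ.span_eq, he.form_apply, he.eq_sum] with y hG hform hsum
  refine le_antisymm (Submodule.span_le.2 ?_) fun v hv => ?_
  · rintro _ ⟨a, rfl⟩
    exact (mem_commonZeros_iff hG).2 fun i =>
      (hform (.inl i) (.inr a)).trans (Matrix.one_apply_ne Sum.inl_ne_inr)
  · rw [hsum v, Fintype.sum_sum_type]
    refine Submodule.add_mem _ (Submodule.sum_mem _ fun i _ => ?_)
      (Submodule.sum_mem _ fun a _ => Submodule.smul_mem _ _ (Submodule.subset_span ⟨a, rfl⟩))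
    rw [Sum.elim_inl, (mem_commonZeros_iff hG).1 hv i, zero_smul]
    exact Submodule.zero_mem _

end CommonZeros

section AdaptedFrames

variable {X : Type*} [TopologicalSpace X] [ChartedSpace ℂ X] [IsManifold 𝓘(ℂ, ℂ) ω X]
  {F : Type*} [NormedAddCommGroup F] [NormedSpace ℂ F]
  {E : X → Type*} [TopologicalSpace (TotalSpace F E)]
  [∀ x, AddCommGroup (E x)] [∀ x, Module ℂ (E x)] [∀ x, TopologicalSpace (E x)]
  [∀ x, IsTopologicalAddGroup (E x)] [∀ x, ContinuousSMul ℂ (E x)]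
  [FiberBundle F E] [VectorBundle ℂ F E]

/-- The subbundles `L` and `V` are in the position of the first and the last step of the filtration
of an oper: fewer than `N` derivatives of a section of `L` stay in `V`, and the `N`-th one induces
an isomorphism `L ≃ E / V` (twisted by `K^N`; the twist is trivialized by the chart at `x`). -/
structure IsOperPair (D : CovariantDerivative 𝓘(ℂ, ℂ) F E) (N : ℕ)
    (L V : ∀ x, Submodule ℂ (E x)) : Prop where
  left_sub : IsHolSubbundle F L
  right_sub : IsHolSubbundle F V
  iterate_mem : ∀ x, ∀ s ∈ holGerms F x, (∀ᶠ y in 𝓝 x, s y ∈ L y) →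
    ∀ j < N, ∀ᶠ y in 𝓝 x, (nabla D x)^[j] s y ∈ V y
  exists_symbol : ∀ x, ∃ σ : L x →ₗ[ℂ] E x ⧸ V x, Function.Bijective σ ∧
    ∀ s ∈ holGerms F x, ∀ hs : ∀ᶠ y in 𝓝 x, s y ∈ L y,
      σ ⟨s x, hs.self_of_nhds⟩ = (V x).mkQ ((nabla D x)^[N] s x)

/-- A frame `s` of `L` and a frame `φ` of the annihilator of `V` for which `φ i` and the `N`-th
derivatives of `s j` are dual, as exist for an oper pair. -/
structure IsAdaptedFrameAt (D : CovariantDerivative 𝓘(ℂ, ℂ) F E) (N : ℕ)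
    (L V : ∀ x, Submodule ℂ (E x)) {ι : Type*} [Fintype ι] [DecidableEq ι] (x : X)
    (s : ι → Π y, E y) (φ : ι → Π y, Dual E y) : Prop where
  frame : IsFrameAt F x L s
  coframe : IsQuotCoframeAt F x V φ fun i => (nabla D x)^[N] (s i)
  iterate_mem : ∀ᶠ y in 𝓝 x, ∀ j < N, ∀ i, (nabla D x)^[j] (s i) y ∈ V y
  form_apply : ∀ᶠ y in 𝓝 x, ∀ i j,
    (φ i y ((nabla D x)^[N] (s j) y) : ℂ) = (1 : Matrix ι ι ℂ) i j

variable {D : CovariantDerivative 𝓘(ℂ, ℂ) F E} {N : ℕ} {L V : ∀ x, Submodule ℂ (E x)}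
  {ι : Type*} [Fintype ι] [DecidableEq ι] {x : X} {s : ι → Π y, E y} {φ : ι → Π y, Dual E y}

theorem IsAdaptedFrameAt.frame_annihilator (h : IsAdaptedFrameAt D N L V x s φ) :
    IsFrameAt (F →L[ℂ] ℂ) x (dualAnnihilator V) φ where
  mem := h.coframe.form_mem
  linearIndependent := by
    refine Fintype.linearIndependent_iff.2 fun c hc j => ?_
    have hj := congrArg (fun ψ : Dual E x => (ψ ((nabla D x)^[N] (s j) x) : ℂ)) hc
    simp only [sum_smul_apply, h.form_apply.self_of_nhds, Matrix.one_apply] at hj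
    simpa using hj
  span_eq := by
    filter_upwards [h.coframe.form_eq_zero, h.coframe.sub_mem] with y hzero hsub
    refine le_antisymm (Submodule.span_le.2 ?_) fun ψ hψ => ?_
    · rintro _ ⟨i, rfl⟩ v hv
      exact hzero i v hv
    · have hψ_eq : ψ = ∑ i, (ψ ((nabla D x)^[N] (s i) y) : ℂ) • φ i y :=
        ContinuousLinearMap.ext fun v => by
          have hv : (ψ (v - ∑ i, (φ i y v : ℂ) • (nabla D x)^[N] (s i) y) : ℂ) = 0 :=
            hψ _ (hsub v)
          refine (sub_eq_zero.1 ((map_sub ψ _ _).symm.trans hv)).trans ?_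
          refine (apply_sum_smul ψ _ _).trans (Eq.trans ?_ (sum_smul_apply _ _ _).symm)
          exact Finset.sum_congr rfl fun i _ => mul_comm _ _
      exact hψ_eq ▸ Submodule.sum_mem _ fun i _ =>
        Submodule.smul_mem _ _ (Submodule.subset_span ⟨i, rfl⟩)

variable [FiniteDimensional ℂ F]

theorem IsOperPair.exists_isFrameAt_sumElim (h : IsOperPair D N L V) (hD : IsHolConnection D)
    (x : X) : ∃ (l r : ℕ) (v : Fin l → Π y, E y) (s : Fin r → Π y, E y),
      IsFrameAt F x V v ∧ IsFrameAt F x L s ∧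
      IsFrameAt F x (fun _ => ⊤) (Sum.elim v fun i => (nabla D x)^[N] (s i)) := by
  obtain ⟨l, v, hv⟩ := h.right_sub.exists_isFrameAt x
  obtain ⟨r, s, hs⟩ := h.left_sub.exists_isFrameAt x
  obtain ⟨σ, hσ, hσs⟩ := h.exists_symbol x
  let vx : Fin l → V x := fun i => ⟨v i x, hv.eventually_mem_subspace.self_of_nhds i⟩
  let sx : Fin r → L x := fun i => ⟨s i x, hs.eventually_mem_subspace.self_of_nhds i⟩
  have hvx : LinearIndependent ℂ vx := .of_comp (V x).subtype hv.linearIndependent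
  have hsx : LinearIndependent ℂ sx := .of_comp (L x).subtype hs.linearIndependent
  have hsx_span : Submodule.span ℂ (Set.range sx) = ⊤ := by
    refine Submodule.map_injective_of_injective (L x).injective_subtype ?_
    rw [Submodule.map_span, Submodule.map_subtype_top, ← Set.range_comp]
    exact hs.span_eq.self_of_nhds
  have hsymbol : σ ∘ sx = (V x).mkQ ∘ fun i => (nabla D x)^[N] (s i) x := funext fun i =>
    hσs (s i) (hs.mem i) (hs.eventually_mem_subspace.mono fun y hy => hy i)
  have helim : (fun i => Sum.elim v (fun i => (nabla D x)^[N] (s i)) i x) =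
      Sum.elim (fun i => (vx i : E x)) fun i => (nabla D x)^[N] (s i) x := by
    ext (i | i) <;> rfl
  refine ⟨l, r, v, s, hv, hs, isFrameAt_top
    (Sum.rec hv.mem fun i => iterate_nabla_mem_holGerms hD (hs.mem i) N) ?_ ?_⟩
  · rw [helim]
    refine hvx.sumElim_of_quotient _ ?_
    exact hsymbol ▸ hsx.map' σ (LinearMap.ker_eq_bot.2 hσ.1)
  · rw [helim, Set.Sum.elim_range, Submodule.span_union, hv.span_eq.self_of_nhds,
      ← Submodule.map_mkQ_eq_top, Submodule.map_span, ← Set.range_comp, ← hsymbol, Set.range_comp,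
      ← Submodule.map_span, hsx_span, Submodule.map_top, LinearMap.range_eq_top.2 hσ.2]

theorem IsOperPair.exists_isAdaptedFrameAt (h : IsOperPair D N L V) (hD : IsHolConnection D)
    (x : X) : ∃ (r : ℕ) (s : Fin r → Π y, E y) (φ : Fin r → Π y, Dual E y),
      IsAdaptedFrameAt D N L V x s φ := by
  obtain ⟨l, r, v, s, hv, hs, he⟩ := h.exists_isFrameAt_sumElim hD x
  obtain ⟨ψ, hψ⟩ := he.exists_isDualFrameAt
  refine ⟨r, s, fun i => ψ (.inr i), hs, ⟨fun i => hψ.form_mem _, fun i => hψ.mem (.inr i), ?_, ?_⟩,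
    ?_, hψ.form_apply.mono fun y hy i j => (hy (.inr i) (.inr j)).trans
      (by simp only [Matrix.one_apply, Sum.inr.injEq])⟩
  · filter_upwards [hv.span_eq, hψ.form_apply] with y hspan hform i w hw
    obtain ⟨c, rfl⟩ := (Submodule.mem_span_range_iff_exists_fun ℂ).1 (hspan.ge hw)
    rw [apply_sum_smul]
    exact Finset.sum_eq_zero fun k _ => by
      rw [show (ψ (.inr i) y (v k y) : ℂ) = 0 from
        (hform (.inr i) (.inl k)).trans (Matrix.one_apply_ne Sum.inr_ne_inl), mul_zero]
  · filter_upwards [hv.span_eq, hψ.eq_sum] with y hspan hsum w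
    have hw := hsum w
    rw [Fintype.sum_sum_type, ← sub_eq_iff_eq_add] at hw
    refine (Eq.symm hw) ▸ Submodule.sum_mem _ fun k _ => Submodule.smul_mem _ _ ?_
    exact hspan ▸ Submodule.subset_span ⟨k, rfl⟩
  · refine (Filter.eventually_all_finite (Set.finite_lt_nat N)).2 fun j hj =>
      eventually_all.2 fun i => h.iterate_mem x (s i) (hs.mem i)
        (hs.eventually_mem_subspace.mono fun y hy => hy i) j hj

variable [ContMDiffVectorBundle ω F E 𝓘(ℂ, ℂ)]

/-- The matrix of the pairing between the derived frames of the annihilator of `V` and of `L`. -/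
def pairingMatrix {ι : Type*} (D : CovariantDerivative 𝓘(ℂ, ℂ) F E)
    (N : ℕ) (x : X) (s : ι → Π y, E y) (φ : ι → Π y, Dual E y) (y : X) :
    Matrix (Fin (N + 1) × ι) (Fin (N + 1) × ι) ℂ :=
  Matrix.of fun p q =>
    (derivedFrame (dualConnection D) x φ N p y (derivedFrame D x s N q y) : ℂ)

theorem pairingMatrix_mulVec {ι : Type*} [Fintype ι] {s : ι → Π y, E y} {φ : ι → Π y, Dual E y}
    (x : X) (u : Fin (N + 1) × ι → ℂ) (p : Fin (N + 1) × ι) (y : X) :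
    (pairingMatrix D N x s φ y).mulVec u p =
      (derivedFrame (dualConnection D) x φ N p y (∑ q, u q • derivedFrame D x s N q y) : ℂ) := by
  rw [apply_sum_smul]
  exact Finset.sum_congr rfl fun q _ => mul_comm _ _

namespace IsAdaptedFrameAt

theorem eventually_pairing (h : IsAdaptedFrameAt D N L V x s φ) (hD : IsHolConnection D)
    {k j : ℕ} (hkj : k + j ≤ N) (i l : ι) : ∀ᶠ y in 𝓝 x,
      ((nabla (dualConnection D) x)^[k] (φ i) y ((nabla D x)^[j] (s l) y) : ℂ) =
        ((-1) ^ k * if k + j = N then (1 : Matrix ι ι ℂ) i l else 0 : ℂ) := by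
  induction k generalizing j with
  | zero =>
    rcases (show j ≤ N by omega).lt_or_eq with hj | rfl
    · filter_upwards [h.iterate_mem, h.coframe.form_eq_zero] with y hy hφ
      rw [Function.iterate_zero, id_eq, hφ i _ (hy j hj l), if_neg (by omega), mul_zero]
    · filter_upwards [h.form_apply] with y hy
      rw [Function.iterate_zero, id_eq, hy, if_pos (zero_add j), pow_zero, one_mul]
  | succ k ih =>
    filter_upwards [ih (j := j + 1) (by omega),
      eventually_nabla_dualConnection_apply
        (iterate_nabla_mem_holGerms hD.dualConnection (h.coframe.form_mem i) k)
        (iterate_nabla_mem_holGerms hD (h.frame.mem l) j) (ih (j := j) (by omega))]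
        with y hk hy
    rw [Function.iterate_succ_apply', hy, ← Function.iterate_succ_apply' (nabla D x), hk, pow_succ,
      show k + (j + 1) = k + 1 + j by omega]
    ring

theorem holAt_pairingMatrix (h : IsAdaptedFrameAt D N L V x s φ) (hD : IsHolConnection D)
    (p q : Fin (N + 1) × ι) : HolAt (fun y => pairingMatrix D N x s φ y p q) x :=
  holAt_pairing (iterate_nabla_mem_holGerms hD.dualConnection (h.coframe.form_mem p.2) p.1)
    (iterate_nabla_mem_holGerms hD (h.frame.mem q.2) q.1)

theorem det_pairingMatrix_ne_zero (h : IsAdaptedFrameAt D N L V x s φ) (hD : IsHolConnection D) :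
    (pairingMatrix D N x s φ x).det ≠ 0 := by
  refine det_ne_zero_of_antitriangular (c := fun k => (-1) ^ k)
    (fun k => pow_ne_zero k (neg_ne_zero.2 one_ne_zero)) (fun p q hpq => ?_) fun p q hpq => ?_
  · refine (h.eventually_pairing hD hpq.le p.2 q.2).self_of_nhds.trans ?_
    rw [if_neg hpq.ne, mul_zero]
  · refine (h.eventually_pairing hD hpq.le p.2 q.2).self_of_nhds.trans ?_
    rw [if_pos hpq]

theorem isDerivedFrameAt (h : IsAdaptedFrameAt D N L V x s φ) (hD : IsHolConnection D) :
    IsDerivedFrameAt F D x L s N where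
  toIsFrameAt := h.frame
  derived_linearIndependent := by
    refine Fintype.linearIndependent_iff.2 fun u hu => congrFun (Matrix.eq_zero_of_mulVec_eq_zero
      (h.det_pairingMatrix_ne_zero hD) (funext fun p => ?_))
    rw [pairingMatrix_mulVec, hu]
    exact map_zero _

theorem isDerivedFrameAt_dual (h : IsAdaptedFrameAt D N L V x s φ) (hD : IsHolConnection D) :
    IsDerivedFrameAt (F →L[ℂ] ℂ) (dualConnection D) x (dualAnnihilator V) φ N where
  toIsFrameAt := h.frame_annihilator
  derived_linearIndependent := by
    refine Fintype.linearIndependent_iff.2 fun u hu => congrFun (Matrix.eq_zero_of_vecMul_eq_zero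
      (h.det_pairingMatrix_ne_zero hD) (funext fun q => ?_))
    have hq := congrArg (fun ψ : Dual E x => (ψ (derivedFrame D x s N q x) : ℂ)) hu
    exact (sum_smul_apply u _ _).symm.trans hq

end IsAdaptedFrameAt

theorem IsOperPair.exists_isDerivedFrameAt (h : IsOperPair D N L V) (hD : IsHolConnection D)
    (x : X) : ∃ (ι : Type) (_ : Finite ι) (s : ι → Π y, E y), IsDerivedFrameAt F D x L s N := by
  obtain ⟨r, s, φ, hs⟩ := h.exists_isAdaptedFrameAt hD x
  exact ⟨Fin r, inferInstance, s, hs.isDerivedFrameAt hD⟩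

theorem IsOperPair.exists_isDerivedFrameAt_dual (h : IsOperPair D N L V) (hD : IsHolConnection D)
    (x : X) : ∃ (ι : Type) (_ : Finite ι) (φ : ι → Π y, Dual E y),
      IsDerivedFrameAt (F →L[ℂ] ℂ) (dualConnection D) x (dualAnnihilator V) φ N := by
  obtain ⟨r, s, φ, hs⟩ := h.exists_isAdaptedFrameAt hD x
  exact ⟨Fin r, inferInstance, φ, hs.isDerivedFrameAt_dual hD⟩

theorem IsOperPair.isHolSubbundle_iterate_Dhat (h : IsOperPair D N L V) (hD : IsHolConnection D) :
    IsHolSubbundle F ((Dhat D)^[N] L) :=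
  isHolSubbundle_of_isFrameAt fun x =>
    have ⟨_, _, _, hs⟩ := h.exists_isDerivedFrameAt hD x
    ⟨_, inferInstance, _, isFrameAt_iterate_Dhat hD (h.exists_isDerivedFrameAt hD) hs le_rfl⟩

theorem IsOperPair.isHolSubbundle_commonZeros (h : IsOperPair D N L V) (hD : IsHolConnection D) :
    IsHolSubbundle F (commonZeros ((Dhat (dualConnection D))^[N] (dualAnnihilator V))) :=
  Quasioper.isHolSubbundle_commonZeros fun x =>
    have ⟨_, _, _, hφ⟩ := h.exists_isDerivedFrameAt_dual hD x
    ⟨_, inferInstance, _, isFrameAt_iterate_Dhat hD.dualConnection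
      (h.exists_isDerivedFrameAt_dual hD) hφ le_rfl⟩

end AdaptedFrames

section JetGerms

variable {X : Type*} [TopologicalSpace X] [ChartedSpace ℂ X]
  {V : X → Type*} [∀ x, AddCommGroup (V x)] [∀ x, Module ℂ (V x)] {Γ : HolGerms V} {k : ℕ} {x : X}

theorem jetGerms_congr {ρ ρ' : Π y, JetFiber Γ k y} (hρ : ρ ∈ jetGerms Γ k x)
    (h : ∀ᶠ y in 𝓝 x, ρ' y = ρ y) : ρ' ∈ jetGerms Γ k x := by
  rw [← add_sub_cancel ρ ρ']
  refine Submodule.add_mem _ hρ (Submodule.subset_span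
    ⟨fun _ => 0, 0, holAt_const 0 x, (Γ x).zero_mem, h.mono fun y hy => ?_⟩)
  rw [zero_smul, Pi.sub_apply, hy, sub_self]

theorem sum_smul_jetAt_mem_jetGerms {ι : Type*} [Fintype ι] {g : ι → X → ℂ} {τ : ι → Π y, V y}
    (hg : ∀ i, HolAt (g i) x) (hτ : ∀ i, τ i ∈ Γ x) :
    (fun y => ∑ i, g i y • jetAt Γ k y (τ i)) ∈ jetGerms Γ k x := by
  have hsum : (fun y => ∑ i, g i y • jetAt Γ k y (τ i)) =
      ∑ i, fun y => g i y • jetAt Γ k y (τ i) := by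
    ext y
    rw [Finset.sum_apply]
  rw [hsum]
  exact Submodule.sum_mem _ fun i _ => Submodule.subset_span
    ⟨g i, τ i, hg i, hτ i, .of_forall fun _ => rfl⟩

end JetGerms

section FlatJetMap

variable {X : Type*} [TopologicalSpace X] [ChartedSpace ℂ X] [IsManifold 𝓘(ℂ, ℂ) ω X]
  {F : Type*} [NormedAddCommGroup F] [NormedSpace ℂ F]
  {E : X → Type*} [TopologicalSpace (TotalSpace F E)]
  [∀ x, AddCommGroup (E x)] [∀ x, Module ℂ (E x)] [∀ x, TopologicalSpace (E x)]
  [∀ x, IsTopologicalAddGroup (E x)] [∀ x, ContinuousSMul ℂ (E x)]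
  [FiberBundle F E] [VectorBundle ℂ F E] [ContMDiffVectorBundle ω F E 𝓘(ℂ, ℂ)]
  {D : CovariantDerivative 𝓘(ℂ, ℂ) F E} {N : ℕ} {L V : ∀ x, Submodule ℂ (E x)}

/-- The fibre coordinates near `x` on the bundle of `N`-jets of sections of `E / V` given by the
derivatives, with respect to the chart at `x`, of the components with respect to `φ`. -/
def jetCoord (F : Type*) [NormedAddCommGroup F] [NormedSpace ℂ F]
    {E : X → Type*} [TopologicalSpace (TotalSpace F E)]
    [∀ x, AddCommGroup (E x)] [∀ x, Module ℂ (E x)] [∀ x, TopologicalSpace (E x)]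
    [FiberBundle F E] [VectorBundle ℂ F E] (V : ∀ x, Submodule ℂ (E x)) (N : ℕ) (x : X) {ι : Type*}
    (φ : ι → Π y, Dual E y) (p : Fin (N + 1) × ι) (y : X) :
    JetFiber (quotGerms F V) N y →ₗ[ℂ] ℂ :=
  jetForm (quotGerms F V) N x (quotForm V (φ p.2)) p.1 y

section Coordinates

variable {ι : Type*} [Fintype ι] {x : X} {φ : ι → Π y, Dual E y} {t : ι → Π y, E y}

theorem IsQuotCoframeAt.eventually_eq_of_jetCoord_eq (h : IsQuotCoframeAt F x V φ t) :
    ∀ᶠ y in 𝓝 x, ∀ J J' : JetFiber (quotGerms F V) N y,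
      (∀ p, jetCoord F V N x φ p y J = jetCoord F V N x φ p y J') → J = J' := by
  filter_upwards [h.eventually_isQuotCoframeAt, eventually_mem_chart_source x] with y hy hyx J J' hJ
  refine sub_eq_zero.1 (eq_zero_of_jetForm_eq_zero hyx hy.isCoframeAt fun p => ?_)
  rw [map_sub]
  exact sub_eq_zero.2 (hJ p)

theorem IsQuotCoframeAt.holAt_jetCoord (h : IsQuotCoframeAt F x V φ t)
    {ρ : Π y, JetFiber (quotGerms F V) N y} (hρ : ρ ∈ jetGerms (quotGerms F V) N x)
    (p : Fin (N + 1) × ι) : HolAt (fun y => jetCoord F V N x φ p y (ρ y)) x :=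
  holAt_jetForm (fun _ => eventually_mem_quotGerms)
    (h.eventually_isQuotCoframeAt.mono fun _ hy => hy.isCoframeAt) p.1 p.2 hρ

variable [FiniteDimensional ℂ F]

theorem IsQuotCoframeAt.eventually_jetCoord_flat (h : IsQuotCoframeAt F x V φ t)
    (hD : IsHolConnection D) : ∀ᶠ y in 𝓝 x, ∀ v w, IsFlatThrough D y v w →
      ∀ p, jetCoord F V N x φ p y (jetAt (quotGerms F V) N y fun z => (V z).mkQ (w z)) =
        derivedFrame (dualConnection D) x φ N p y v := by
  have hφ : ∀ᶠ y in 𝓝 x, ∀ j < N, ∀ i,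
      (nabla (dualConnection D) x)^[j] (φ i) ∈ holGerms (F →L[ℂ] ℂ) y :=
    (Filter.eventually_all_finite (Set.finite_lt_nat N)).2 fun j _ => eventually_all.2 fun i =>
      eventually_mem_holGerms (iterate_nabla_mem_holGerms hD.dualConnection (h.form_mem i) j)
  filter_upwards [h.eventually_isQuotCoframeAt, eventually_mem_chart_source x, hφ]
    with y hy hyx hφy v w ⟨hw, hflat, hwy⟩ p
  have hpair : (fun z => quotForm V (φ p.2) z ((V z).mkQ (w z))) ∘ (chartAt ℂ x).symm
      =ᶠ[𝓝 (chartAt ℂ x y)] (fun z => (φ p.2 z (w z) : ℂ)) ∘ (chartAt ℂ x).symm :=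
    (tendsto_chartAt_symm hyx).eventually
      (hy.form_eq_zero.mono fun z hz => quotForm_mkQ (hz p.2) (w z))
  calc jetCoord F V N x φ p y (jetAt (quotGerms F V) N y fun z => (V z).mkQ (w z))
    _ = taylorCoeff x (quotForm V (φ p.2)) p.1 y fun z => (V z).mkQ (w z) :=
      jetForm_jetAt hyx hy.isCoframeAt p.1 p.2 (mkQ_mem_quotGerms hw)
    _ = iteratedDeriv p.1 ((fun z => (φ p.2 z (w z) : ℂ)) ∘ (chartAt ℂ x).symm) (chartAt ℂ x y) :=
      hpair.iteratedDeriv_eq _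
    _ = derivedFrame (dualConnection D) x φ N p y (w y) :=
      (eventually_iteratedDeriv_flat_pairing hyx hw hflat fun j hj =>
        hφy j (by omega) p.2).self_of_nhds
    _ = derivedFrame (dualConnection D) x φ N p y v := by rw [hwy]

theorem IsFlatJetMap.eventually_jetCoord {f : ∀ x, E x →ₗ[ℂ] JetFiber (quotGerms F V) N x}
    (hf : IsFlatJetMap D V N f) (hD : IsHolConnection D) (h : IsQuotCoframeAt F x V φ t) :
    ∀ᶠ y in 𝓝 x, ∀ v p,
      jetCoord F V N x φ p y (f y v) = derivedFrame (dualConnection D) x φ N p y v := by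
  filter_upwards [h.eventually_jetCoord_flat hD (N := N)] with y hy v p
  obtain ⟨w, hw⟩ := (hf y v).1
  rw [(hf y v).2 w hw, hy v w hw p]

end Coordinates

variable [FiniteDimensional ℂ F]

theorem IsOperPair.exists_isFlatJetMap (h : IsOperPair D N L V) (hD : IsHolConnection D) :
    ∃ f, IsFlatJetMap D V N f := by
  have hx : ∀ x, ∃ f : E x →ₗ[ℂ] JetFiber (quotGerms F V) N x, ∀ v s, IsFlatThrough D x v s →
      f v = jetAt (quotGerms F V) N x fun y => (V y).mkQ (s y) := by
    intro x
    have := finiteDimensional_fiber F (E := E) x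
    obtain ⟨r, s, φ, hs⟩ := h.exists_isAdaptedFrameAt hD x
    have hcoord := (hs.coframe.eventually_jetCoord_flat hD (N := N)).self_of_nhds
    choose w hw using exists_isFlatThrough hD x
    let b := Module.finBasis ℂ (E x)
    refine ⟨b.constr ℂ fun i => jetAt (quotGerms F V) N x fun y => (V y).mkQ (w (b i) y),
      fun v s hvs => hs.coframe.eventually_eq_of_jetCoord_eq.self_of_nhds _ _ fun p => ?_⟩
    rw [hcoord v s hvs, b.constr_apply_fintype ℂ, map_sum]
    simp only [map_smul, hcoord _ _ (hw _), smul_eq_mul]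
    exact (apply_sum_smul _ _ _).symm.trans (congrArg _ (b.sum_equivFun v))
  choose f hf using hx
  exact ⟨f, fun x v => ⟨exists_isFlatThrough hD x v, hf x v⟩⟩

namespace IsFlatJetMap

variable {f : ∀ x, E x →ₗ[ℂ] JetFiber (quotGerms F V) N x}

theorem isHolHom (hf : IsFlatJetMap D V N f) :
    IsHolHom (holGerms F) (jetGerms (quotGerms F V) N) f := by
  intro x σ hσ
  have := finiteDimensional_fiber F (E := E) x
  let b := Module.finBasis ℂ (E x)
  choose w hw using fun i => (hf x (b i)).1
  have hwx : (fun i => w i x) = b := funext fun i => (hw i).2.2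
  have hframe : IsFrameAt F x (fun _ => ⊤) w := isFrameAt_top (fun i => (hw i).1)
    (hwx ▸ b.linearIndependent) (hwx ▸ b.span_eq)
  obtain ⟨u, hu, hσu⟩ := hframe.exists_coeff hσ (.of_forall fun _ => Submodule.mem_top)
  refine jetGerms_congr (sum_smul_jetAt_mem_jetGerms hu fun i =>
    mkQ_mem_quotGerms (V := V) (hw i).1) ?_
  filter_upwards [hσu, eventually_all.2 fun i => eventually_mem_holGerms (hw i).1,
    eventually_all.2 fun i => (hw i).2.1.eventually_nhds] with y hσy hwy hflat
  rw [hσy, map_sum]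
  exact Finset.sum_congr rfl fun i _ => by
    rw [map_smul, (hf y (w i y)).2 (w i) ⟨hwy i, hflat i, rfl⟩]

theorem bijective (hf : IsFlatJetMap D V N f) (hD : IsHolConnection D) (h : IsOperPair D N L V)
    (x : X) : Function.Bijective ((f x).domRestrict ((Dhat D)^[N] L x)) := by
  obtain ⟨r, s, φ, hs⟩ := h.exists_isAdaptedFrameAt hD x
  have hspan := (isFrameAt_iterate_Dhat hD (h.exists_isDerivedFrameAt hD)
    (hs.isDerivedFrameAt hD) le_rfl).span_eq.self_of_nhds
  have hcoord := (hf.eventually_jetCoord hD hs.coframe).self_of_nhds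
  have hdet := hs.det_pairingMatrix_ne_zero hD
  constructor
  · rw [← LinearMap.ker_eq_bot, LinearMap.ker_eq_bot']
    rintro ⟨v, hv⟩ (hfv : f x v = 0)
    obtain ⟨u, rfl⟩ := (Submodule.mem_span_range_iff_exists_fun ℂ).1 (hspan.ge hv)
    have hu : u = 0 := Matrix.eq_zero_of_mulVec_eq_zero hdet (funext fun p => by
      rw [pairingMatrix_mulVec, ← hcoord, hfv, map_zero, Pi.zero_apply])
    exact Subtype.ext (by simp only [hu, Pi.zero_apply, zero_smul, Finset.sum_const_zero]; rfl)
  · intro J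
    obtain ⟨u, hu⟩ := (Matrix.mulVec_surjective_iff_isUnit.2
      ((Matrix.isUnit_iff_isUnit_det _).2 (isUnit_iff_ne_zero.2 hdet)))
      fun p => jetCoord F V N x φ p x J
    have hmem : ∑ q, u q • derivedFrame D x s N q x ∈ (Dhat D)^[N] L x :=
      hspan.le (Submodule.sum_mem _ fun q _ =>
        Submodule.smul_mem _ (u q) (Submodule.subset_span ⟨q, rfl⟩))
    refine ⟨⟨_, hmem⟩, hs.coframe.eventually_eq_of_jetCoord_eq.self_of_nhds _ J fun p => ?_⟩
    rw [LinearMap.domRestrict_apply, hcoord, ← pairingMatrix_mulVec, hu]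

theorem mem_holGerms_of_mem_jetGerms (hf : IsFlatJetMap D V N f) (hD : IsHolConnection D)
    (h : IsOperPair D N L V) {x : X} {σ : Π y, E y} (hσ : ∀ᶠ y in 𝓝 x, σ y ∈ (Dhat D)^[N] L y)
    (hfσ : (fun y => f y (σ y)) ∈ jetGerms (quotGerms F V) N x) : σ ∈ holGerms F x := by
  obtain ⟨r, s, φ, hs⟩ := h.exists_isAdaptedFrameAt hD x
  have hframe := isFrameAt_iterate_Dhat hD (h.exists_isDerivedFrameAt hD)
    (hs.isDerivedFrameAt hD) le_rfl
  have hcoeff : ∀ᶠ y in 𝓝 x, ∃ u : Fin (N + 1) × Fin r → ℂ,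
      σ y = ∑ q, u q • derivedFrame D x s N q y := by
    filter_upwards [hframe.span_eq, hσ] with y hspan hy
    obtain ⟨u, hu⟩ := (Submodule.mem_span_range_iff_exists_fun ℂ).1 (hspan.ge hy)
    exact ⟨u, hu.symm⟩
  obtain ⟨u, hu⟩ := hcoeff.choice
  have hu_hol : ∀ q, HolAt (fun y => u y q) x := by
    refine holAt_of_mulVec_eq (hs.holAt_pairingMatrix hD) (hs.coframe.holAt_jetCoord hfσ)
      (hs.det_pairingMatrix_ne_zero hD) ?_
    filter_upwards [hu, hf.eventually_jetCoord hD hs.coframe] with y hy hcoord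
    funext p
    rw [pairingMatrix_mulVec, ← hy, hcoord]
  exact holGerms_congr (sum_smul_mem_holGerms (fun q _ => hu_hol q) fun q _ => hframe.mem q) hu

theorem isHolIso (hf : IsFlatJetMap D V N f) (hD : IsHolConnection D) (h : IsOperPair D N L V) :
    IsHolIso (subGerms F ((Dhat D)^[N] L)) (jetGerms (quotGerms F V) N)
      fun x => (f x).domRestrict ((Dhat D)^[N] L x) :=
  ⟨hf.bijective hD h, fun x σ => ⟨fun hσ => hf.isHolHom x _ hσ,
    hf.mem_holGerms_of_mem_jetGerms hD h (.of_forall fun y => (σ y).2)⟩⟩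

theorem ker_eq_commonZeros (hf : IsFlatJetMap D V N f) (hD : IsHolConnection D)
    (h : IsOperPair D N L V) (x : X) : LinearMap.ker (f x) =
      commonZeros ((Dhat (dualConnection D))^[N] (dualAnnihilator V)) x := by
  obtain ⟨r, s, φ, hs⟩ := h.exists_isAdaptedFrameAt hD x
  have hspan := (isFrameAt_iterate_Dhat hD.dualConnection (h.exists_isDerivedFrameAt_dual hD)
    (hs.isDerivedFrameAt_dual hD) le_rfl).span_eq.self_of_nhds
  have hcoord := (hf.eventually_jetCoord hD hs.coframe).self_of_nhds
  ext v
  rw [LinearMap.mem_ker, mem_commonZeros_iff hspan]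
  refine ⟨fun hv p => by rw [← hcoord, hv, map_zero], fun hv => ?_⟩
  refine hs.coframe.eventually_eq_of_jetCoord_eq.self_of_nhds _ _ fun p => ?_
  rw [hcoord, map_zero]
  exact hv p

end IsFlatJetMap

end FlatJetMap

section Symbols

variable {X : Type*} [TopologicalSpace X] [ChartedSpace ℂ X] [IsManifold 𝓘(ℂ, ℂ) ω X]

theorem bijective_apply_dz {W : Type*} [AddCommGroup W] [Module ℂ W] (x : X) :
    Function.Bijective fun φ : TangentSpace 𝓘(ℂ, ℂ) x →ₗ[ℂ] W => φ (dz x x) := by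
  refine ⟨fun φ ψ (h : φ (dz x x) = ψ (dz x x)) => LinearMap.ext fun v => ?_, fun w => ?_⟩
  · obtain ⟨c, rfl⟩ := exists_eq_smul_dz (mem_chart_source ℂ x) v
    rw [map_smul, map_smul, h]
  · let d : ℂ := dz x x
    have hd : d ≠ 0 := dz_ne_zero
    exact ⟨(LinearMap.id : ℂ →ₗ[ℂ] ℂ).smulRight (d⁻¹ • w), smul_inv_smul₀ hd w⟩

variable {F : Type*} [NormedAddCommGroup F] [NormedSpace ℂ F]
  {E : X → Type*} [TopologicalSpace (TotalSpace F E)]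
  [∀ x, AddCommGroup (E x)] [∀ x, Module ℂ (E x)] [∀ x, TopologicalSpace (E x)]
  [∀ x, IsTopologicalAddGroup (E x)] [∀ x, ContinuousSMul ℂ (E x)]
  [FiberBundle F E] [VectorBundle ℂ F E]
  {D : CovariantDerivative 𝓘(ℂ, ℂ) F E} {L V₁ V₂ V₃ V₄ : ∀ x, Submodule ℂ (E x)} {k : ℕ} {x : X}

/-- `σ` is the symbol at `x` of the `k`-th derivative `L → V₂ / V₁`, with the twist by `K^k`
trivialized by the chart at `x`. -/
def IsSymbolAt (D : CovariantDerivative 𝓘(ℂ, ℂ) F E) (L V₁ V₂ : ∀ x, Submodule ℂ (E x)) (k : ℕ)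
    (x : X) (σ : L x →ₗ[ℂ] Gr V₁ V₂ x) : Prop :=
  ∀ s ∈ holGerms F x, ∀ hs : ∀ᶠ y in 𝓝 x, s y ∈ L y, ∃ h : (nabla D x)^[k] s x ∈ V₂ x,
    σ ⟨s x, hs.self_of_nhds⟩ = Submodule.Quotient.mk ⟨(nabla D x)^[k] s x, h⟩

theorem isSymbolAt_zero (D : CovariantDerivative 𝓘(ℂ, ℂ) F E) (L V : ∀ x, Submodule ℂ (E x))
    (x : X) : IsSymbolAt D L V L 0 x ((V x).submoduleOf (L x)).mkQ :=
  fun _ _ hs => ⟨hs.self_of_nhds, rfl⟩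

theorem IsSymbolAt.succ {σ : L x →ₗ[ℂ] Gr V₁ V₂ x} (hσ : IsSymbolAt D L V₁ V₂ k x σ)
    {S : ∀ x, Gr V₁ V₂ x →ₗ[ℂ] TangentSpace 𝓘(ℂ, ℂ) x →ₗ[ℂ] Gr V₃ V₄ x}
    (hS : IsSecondFundamentalForm D V₁ V₂ V₃ V₄ S) (hD : IsHolConnection D)
    (hmem : ∀ s ∈ holGerms F x, (∀ᶠ y in 𝓝 x, s y ∈ L y) →
      ∀ᶠ y in 𝓝 x, (nabla D x)^[k] s y ∈ V₂ y) :
    IsSymbolAt D L V₃ V₄ (k + 1) x ((S x).flip (dz x x) ∘ₗ σ) := by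
  intro s hs hsL
  obtain ⟨_, hσs⟩ := hσ s hs hsL
  obtain ⟨h, hSs⟩ := hS x _ (iterate_nabla_mem_holGerms hD hs k) (hmem s hs hsL) (dz x x)
  simp only [iterate_nabla_succ]
  exact ⟨h, (congrArg (fun u => S x u (dz x x)) hσs).trans hSs⟩

theorem IsSymbolAt.exists_bijective_of_top {σ : L x →ₗ[ℂ] Gr V₁ ⊤ x}
    (hσ : IsSymbolAt D L V₁ ⊤ k x σ) (hbij : Function.Bijective σ) :
    ∃ τ : L x →ₗ[ℂ] E x ⧸ V₁ x, Function.Bijective τ ∧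
      ∀ s ∈ holGerms F x, ∀ hs : ∀ᶠ y in 𝓝 x, s y ∈ L y,
        τ ⟨s x, hs.self_of_nhds⟩ = (V₁ x).mkQ ((nabla D x)^[k] s x) := by
  let e : Gr V₁ ⊤ x ≃ₗ[ℂ] E x ⧸ V₁ x := Submodule.Quotient.equiv _ _ Submodule.topEquiv
    (Submodule.map_comap_eq_of_surjective Submodule.topEquiv.surjective _)
  refine ⟨e ∘ₗ σ, e.bijective.comp hbij, fun s hs hsL => ?_⟩
  obtain ⟨_, hσs⟩ := hσ s hs hsL
  exact congrArg e hσs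

end Symbols

section Quasiopers

variable {X : Type*} [TopologicalSpace X] [ChartedSpace ℂ X]
  {F : Type*} [NormedAddCommGroup F] [NormedSpace ℂ F]
  {E : X → Type*} [TopologicalSpace (TotalSpace F E)]
  [∀ x, AddCommGroup (E x)] [∀ x, Module ℂ (E x)] [∀ x, TopologicalSpace (E x)]
  [FiberBundle F E] [VectorBundle ℂ F E]
  {m : ℕ} {B : ∀ x, LinearMap.BilinForm ℂ (E x)} {Fil : ℕ → ∀ x, Submodule ℂ (E x)}

theorem IsSOFiltration.le (h : IsSOFiltration (F := F) m B Fil) {i j : ℕ} (hij : i ≤ j)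
    (hj : j ≤ 2 * m + 1) : Fil i ≤ Fil j := by
  induction j, hij using Nat.le_induction with
  | base => exact le_rfl
  | succ j _ ih => exact (ih (by omega)).trans (h.mono j (by omega))

variable [IsManifold 𝓘(ℂ, ℂ) ω X] [∀ x, IsTopologicalAddGroup (E x)]
  [∀ x, ContinuousSMul ℂ (E x)] [ContMDiffVectorBundle ω F E 𝓘(ℂ, ℂ)]
  {D : CovariantDerivative 𝓘(ℂ, ℂ) F E}

namespace IsFilteredConnection

theorem eventually_iterate_nabla_mem (h : IsFilteredConnection m B Fil D) {x : X} {s : Π y, E y}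
    (hs : s ∈ holGerms F x) (hs1 : ∀ᶠ y in 𝓝 x, s y ∈ Fil 1 y) {j : ℕ} (hj : j ≤ 2 * m) :
    ∀ᶠ y in 𝓝 x, (nabla D x)^[j] s y ∈ Fil (j + 1) y := by
  induction j with
  | zero => exact hs1
  | succ j ih =>
    filter_upwards [(ih (by omega)).eventually_nhds,
      eventually_mem_holGerms (iterate_nabla_mem_holGerms h.holomorphic hs j)] with y hy hsy
    rw [iterate_nabla_succ]
    exact h.transversal (j + 1) (Finset.mem_Icc.2 ⟨by omega, hj⟩) y _ hsy hy _

theorem exists_isSymbolAt_succ (h : IsFilteredConnection m B Fil D) {x : X} {j : ℕ}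
    (hj : j + 1 ≤ 2 * m) (hjm : j + 1 ≠ m) (hjm' : j + 1 ≠ m + 1)
    (hσ : ∃ σ, IsSymbolAt D (Fil 1) (Fil j) (Fil (j + 1)) j x σ ∧ Function.Bijective σ) :
    ∃ σ, IsSymbolAt D (Fil 1) (Fil (j + 1)) (Fil (j + 2)) (j + 1) x σ ∧ Function.Bijective σ := by
  obtain ⟨σ, hσ, hbij⟩ := hσ
  obtain ⟨S, hS, hSbij⟩ := h.iso (j + 1) (Finset.mem_Icc.2 ⟨by omega, hj⟩) hjm hjm'
  exact ⟨_, hσ.succ hS h.holomorphic fun s hs hs1 =>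
      h.eventually_iterate_nabla_mem hs hs1 (by omega),
    (bijective_apply_dz x).comp ((hSbij x).comp hbij)⟩

theorem exists_isSymbolAt_middle {l : ℕ} (h : IsFilteredConnection (l + 1) B Fil D) {x : X}
    (hσ : ∃ σ, IsSymbolAt D (Fil 1) (Fil l) (Fil (l + 1)) l x σ ∧ Function.Bijective σ) :
    ∃ σ, IsSymbolAt D (Fil 1) (Fil (l + 2)) (Fil (l + 3)) (l + 2) x σ ∧ Function.Bijective σ := by
  obtain ⟨σ, hσ, hbij⟩ := hσ
  obtain ⟨S, S', hS, hS', hSbij⟩ := h.iso_middle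
  have hmem (j : ℕ) (hj : j ≤ 2 * (l + 1)) (s) (hs : s ∈ holGerms F x)
      (hs1 : ∀ᶠ y in 𝓝 x, s y ∈ Fil 1 y) := h.eventually_iterate_nabla_mem hs hs1 hj
  exact ⟨_, (hσ.succ hS h.holomorphic (hmem l (by omega))).succ hS' h.holomorphic
      (hmem (l + 1) (by omega)),
    (bijective_apply_dz x).comp ((bijective_apply_dz x).comp ((hSbij x).comp hbij))⟩

end IsFilteredConnection

theorem exists_isSymbolAt (hFil : IsSOFiltration (F := F) m B Fil)
    (hD : IsFilteredConnection m B Fil D) (x : X) {j : ℕ} (hj : j ≤ 2 * m) (hjm : j ≠ m) :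
    ∃ σ, IsSymbolAt D (Fil 1) (Fil j) (Fil (j + 1)) j x σ ∧ Function.Bijective σ := by
  have hlow : ∀ j < m,
      ∃ σ, IsSymbolAt D (Fil 1) (Fil j) (Fil (j + 1)) j x σ ∧ Function.Bijective σ := by
    intro j hj
    induction j with
    | zero =>
      refine ⟨_, isSymbolAt_zero D (Fil 1) (Fil 0) x, ?_, Submodule.mkQ_surjective _⟩
      rw [← LinearMap.ker_eq_bot, Submodule.ker_mkQ, hFil.zero]
      exact Submodule.ker_subtype _
    | succ j ih =>
      exact hD.exists_isSymbolAt_succ (by omega) (by omega) (by omega) (ih (by omega))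
  rcases hjm.lt_or_gt with hlt | hgt
  · exact hlow j hlt
  · induction j, hgt using Nat.le_induction with
    | base =>
      obtain ⟨l, rfl⟩ := Nat.exists_eq_add_one.2 (show 0 < m by omega)
      exact hD.exists_isSymbolAt_middle (hlow l (by omega))
    | succ j hmj ih =>
      exact hD.exists_isSymbolAt_succ hj (by omega) (by omega) (ih (by omega) (by omega))

theorem IsQuasioper.isOperPair {n : ℕ} (h : IsQuasioper n m B Fil D) (hm : m ≠ 0) :
    IsOperPair D (2 * m) (Fil 1) (Fil (2 * m)) where
  left_sub := h.filtration.subbundle 1 (by omega)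
  right_sub := h.filtration.subbundle (2 * m) (by omega)
  iterate_mem x s hs hs1 j hj :=
    (h.connection.eventually_iterate_nabla_mem hs hs1 hj.le).mono fun y hy =>
      h.filtration.le (show j + 1 ≤ 2 * m from hj) (by omega) y hy
  exists_symbol x := by
    have hσ := exists_isSymbolAt h.filtration h.connection x le_rfl (show 2 * m ≠ m by omega)
    rw [h.filtration.top] at hσ
    obtain ⟨σ, hσ, hbij⟩ := hσ
    exact hσ.exists_bijective_of_top hbij

end Quasiopers

end Quasioper

end

theorem corollary3p3_general
    {X : Type*} [TopologicalSpace X] [ChartedSpace ℂ X] [IsManifold 𝓘(ℂ, ℂ) ω X]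
    {F : Type*} [NormedAddCommGroup F] [NormedSpace ℂ F] [FiniteDimensional ℂ F]
    {E : X → Type*} [TopologicalSpace (TotalSpace F E)]
    [∀ x, AddCommGroup (E x)] [∀ x, Module ℂ (E x)] [∀ x, TopologicalSpace (E x)]
    [∀ x, IsTopologicalAddGroup (E x)] [∀ x, ContinuousSMul ℂ (E x)]
    [FiberBundle F E] [VectorBundle ℂ F E] [ContMDiffVectorBundle ω F E 𝓘(ℂ, ℂ)]
    (N : ℕ) (L V : ∀ x, Submodule ℂ (E x)) (D : CovariantDerivative 𝓘(ℂ, ℂ) F E)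
    (hD : Quasioper.IsHolConnection D) (h : Quasioper.IsOperPair D N L V) :
    ∃ f : ∀ x, E x →ₗ[ℂ] Quasioper.JetFiber (Quasioper.quotGerms F V) N x,
      Quasioper.IsFlatJetMap D V N f ∧
      Quasioper.IsHolHom (Quasioper.holGerms F)
        (Quasioper.jetGerms (Quasioper.quotGerms F V) N) f ∧
      Quasioper.IsHolSubbundle F ((Quasioper.Dhat D)^[N] L) ∧
      Quasioper.IsHolIso (Quasioper.subGerms F ((Quasioper.Dhat D)^[N] L))
        (Quasioper.jetGerms (Quasioper.quotGerms F V) N)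
        (fun x => (f x).domRestrict ((Quasioper.Dhat D)^[N] L x)) ∧
      Quasioper.IsHolSubbundle F (Quasioper.commonZeros
        ((Quasioper.Dhat (Quasioper.dualConnection D))^[N] (Quasioper.dualAnnihilator V))) ∧
      ∀ x, LinearMap.ker (f x) = Quasioper.commonZeros
        ((Quasioper.Dhat (Quasioper.dualConnection D))^[N] (Quasioper.dualAnnihilator V)) x := by
  obtain ⟨f, hf⟩ := h.exists_isFlatJetMap hD
  exact ⟨f, hf, hf.isHolHom, h.isHolSubbundle_iterate_Dhat hD, hf.isHolIso hD h,
    h.isHolSubbundle_commonZeros hD, hf.ker_eq_commonZeros hD h⟩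

theorem corollary3p3
    {X : Type*} [TopologicalSpace X] [T2Space X] [ConnectedSpace X]
    [ChartedSpace ℂ X] [IsManifold 𝓘(ℂ, ℂ) ω X]
    {F : Type*} [NormedAddCommGroup F] [NormedSpace ℂ F] [FiniteDimensional ℂ F]
    {E : X → Type*} [TopologicalSpace (TotalSpace F E)]
    [∀ x, AddCommGroup (E x)] [∀ x, Module ℂ (E x)] [∀ x, TopologicalSpace (E x)]
    [∀ x, IsTopologicalAddGroup (E x)] [∀ x, ContinuousSMul ℂ (E x)]
    [FiberBundle F E] [VectorBundle ℂ F E] [ContMDiffVectorBundle ω F E 𝓘(ℂ, ℂ)]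
    (n m : ℕ) (hn : 2 ≤ n) (hm : 2 ≤ m)
    (B : ∀ x, LinearMap.BilinForm ℂ (E x)) (Fil : ℕ → ∀ x, Submodule ℂ (E x))
    (D : CovariantDerivative 𝓘(ℂ, ℂ) F E) (h : Quasioper.IsQuasioper n m B Fil D) :
    ∃ f : ∀ x, E x →ₗ[ℂ] Quasioper.JetFiber (Quasioper.quotGerms F (Fil (2 * m))) (2 * m) x,
      -- `f` is the map produced by the flat sections of `D`, and it is holomorphic
      Quasioper.IsFlatJetMap D (Fil (2 * m)) (2 * m) f ∧
      Quasioper.IsHolHom (Quasioper.holGerms F)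
        (Quasioper.jetGerms (Quasioper.quotGerms F (Fil (2 * m))) (2 * m)) f ∧
      -- its restriction to the subbundle `𝔽` is an isomorphism onto the jet bundle
      Quasioper.IsHolSubbundle F (Quasioper.subF m Fil D) ∧
      Quasioper.IsHolIso (Quasioper.subGerms F (Quasioper.subF m Fil D))
        (Quasioper.jetGerms (Quasioper.quotGerms F (Fil (2 * m))) (2 * m))
        (fun x => (f x).domRestrict (Quasioper.subF m Fil D x)) ∧
      -- its kernel is the subbundle `𝒮`
      Quasioper.IsHolSubbundle F (Quasioper.subS m Fil D) ∧
      ∀ x, LinearMap.ker (f x) = Quasioper.subS m Fil D x :=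
  corollary3p3_general (2 * m) (Fil 1) (Fil (2 * m)) D h.connection.holomorphic
    (h.isOperPair (by omega))
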